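/- Let $(Z,d)$ be a compact, connected metric space carrying a Borel regular measure $\mu$ that is Ahlfors $Q$-regular for some $Q>1$, i.e. there are $c,C>0$ with $c\,r^Q\le\mu(B(z,r))\le C\,r^Q$ for all $z\in Z$ and $0<r\le\operatorname{diam}Z$. Suppose that for some $1\le p\le Q$ there is a family $\Gamma$ of nonconstant paths in $Z$ with $\operatorname{mod}_p(\Gamma)>0$. Here a path is a continuous map from an interval into $Z$, and $\operatorname{mod}_p(\Gamma)=\inf\int_Z\rho^p\,d\mu$, where the infimum is over all Borel $\rho\colon Z\to[0,\infty]$ with $\int_\gamma\rho\ge 1$ (arclength integral) for every rectifiable $\gamma\in\Gamma$. A hyperbolic filling $X=(V,E)$ of $Z$ is constructed as follows. Fix $s>1$ and $R>\operatorname{diam}Z$; for each integer $k\ge 0$ choose a maximal set $P_k\subseteq Z$ whose distinct points have mutual distance at least $Rs^{-k}$. The vertex set $V$ is the disjoint union of the $P_k$; a vertex $v$ given by $x\in P_k$ has level $k$, center $x$, and ball $B_v=B(x,2Rs^{-k})$. Distinct vertices are joined by an edge iff their levels differ by at most $1$ and $\overline{B_v}\cap\overline{B_w}\ne\emptyset$.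 A sequence of vertices with centers $x_n$ and radii $r_n$ converges nontangentially to $z\in Z$ if $x_n\to z$, $r_n\to0$ and, for some $C>0$, $d(z,x_n)\le C r_n$ for all $n$. For sets $A,B\subseteq Z$, a function $\tau\colon E\to[0,\infty]$ is admissible if $\sum_{e\in\gamma}\tau(e)\ge1$ for every bi-infinite path $\gamma$ in $X$ whose two ends converge nontangentially to a point of $A$ and to a point of $B$, respectively. For $q>0$ put $\operatorname{wcap}_q(A,B)=\inf\{\|\tau\|_{q,\infty}^q:\tau\text{ admissible}\}$, where $\|\tau\|_{q,\infty}$ is the infimum of all $C>0$ with $\#\{e:\tau(e)>\lambda\}\le C^q/\lambda^q$ for all $\lambda>0$. Finally let $$Q_w=\inf\{q>0:\operatorname{wcap}_q(A,B)<\infty\text{ for all open }A,B\subseteq Z\text{ with }\operatorname{dist}(A,B)>0\},$$ and let $\operatorname{ARCdim}(Z,d)$, the Ahlfors regular conformal dimension, be the infimum of the Hausdorff dimensions of $(Z,\theta)$ over all metrics $\theta$ on $Z$ such that $(Z,\theta)$ is Ahlfors regular (of some exponent, for some Borel measure) and the identity $(Z,d)\to(Z,\theta)$ is a quasisymmetry.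 A map $f$ is a quasisymmetry if, for some homeomorphism $\eta$ of $[0,\infty)$, one has $|f(x)-f(y)|\le\eta(t)|f(x)-f(z)|$ whenever $|x-y|\le t|x-z|$. Then there are open balls $A,B\subseteq Z$ with $\operatorname{dist}(A,B)>0$ such that $\operatorname{wcap}_q(A,B)=\infty$ for every hyperbolic filling of $Z$ and every $0<q<Q$. Consequently $Q_w=\operatorname{ARCdim}(Z,d)=Q$ for every hyperbolic filling of $Z$. -/

import Mathlib

open Set Filter Topology MeasureTheory
open scoped ENNReal NNReal

noncomputable section

/-! ### Metric notions -/

/-- The distance `inf {d(a,b) : a ∈ A, b ∈ B}` between two sets (infinite if one of them is empty). -/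
def setDist {Z : Type*} [MetricSpace Z] (A B : Set Z) : ℝ≥0∞ :=
  ⨅ a ∈ A, ⨅ b ∈ B, edist a b

/-- Ahlfors `Q`-regularity: `c r ^ Q ≤ μ (B(z,r)) ≤ C r ^ Q` for all `z` and `0 < r ≤ diam Z`. -/
def IsAhlforsRegular {Z : Type*} [MetricSpace Z] [MeasurableSpace Z]
    (μ : Measure Z) (Q : ℝ) : Prop :=
  ∃ c C : ℝ, 0 < c ∧ 0 < C ∧ ∀ (z : Z) (r : ℝ), 0 < r →
    ENNReal.ofReal r ≤ Metric.ediam (univ : Set Z) →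
      ENNReal.ofReal (c * r ^ Q) ≤ μ (Metric.ball z r) ∧
        μ (Metric.ball z r) ≤ ENNReal.ofReal (C * r ^ Q)

/-- A metric space is Ahlfors regular if it carries a Borel measure that is Ahlfors `Q`-regular
for some `Q > 0`. -/
def IsAhlforsRegularSpace (Z : Type*) [MetricSpace Z] : Prop :=
  ∃ (Q : ℝ) (ν : @Measure Z (borel Z)), 0 < Q ∧ @IsAhlforsRegular Z _ (borel Z) ν Q

/-- `f` is an `η`-quasisymmetry for some homeomorphism `η` of `[0,∞)`. -/
def IsQuasisymmetry {X Y : Type*} [MetricSpace X] [MetricSpace Y] (f : X → Y) : Prop :=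
  ∃ η : ℝ≥0 ≃ₜ ℝ≥0, ∀ (x y z : X) (t : ℝ≥0),
    dist x y ≤ t * dist x z → dist (f x) (f y) ≤ η t * dist (f x) (f z)

/-- The Ahlfors regular conformal dimension: the infimum of the Hausdorff dimensions of `(Z,θ)`
over all Ahlfors regular metrics `θ` on `Z` for which the identity `(Z,d) → (Z,θ)` is a
quasisymmetry. -/
def arConformalDim (Z : Type*) [d : MetricSpace Z] : ℝ≥0∞ :=
  ⨅ (θ : MetricSpace Z) (_ : @IsQuasisymmetry Z Z d θ id) (_ : @IsAhlforsRegularSpace Z θ),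
    @dimH Z θ.toEMetricSpace univ

/-! ### Paths and modulus -/

/-- A path: a continuous map into `Z` from a nonempty interval `dom ⊆ ℝ`, which need be neither
closed nor bounded (the values of `toFun` off `dom` play no role). -/
structure MetricPath (Z : Type*) [MetricSpace Z] where
  dom : Set ℝ
  ordConnected : dom.OrdConnected
  nonempty : dom.Nonempty
  toFun : ℝ → Z
  continuousOn : ContinuousOn toFun dom

namespace MetricPath

variable {Z : Type*} [MetricSpace Z]

/-- The path takes at least two values. -/
def Nonconstant (γ : MetricPath Z) : Prop :=
  ∃ t ∈ γ.dom, ∃ t' ∈ γ.dom, γ.toFun t ≠ γ.toFun t'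

/-- The path has finite length. -/
def Rectifiable (γ : MetricPath Z) : Prop :=
  eVariationOn γ.toFun γ.dom ≠ ∞

/-- The integral of `ρ` along a rectifiable path with respect to its arclength parameterization.
Arclength is measured from an arbitrary base point of `dom`; the choice only translates the
parameter. -/
def lineIntegral (γ : MetricPath Z) (ρ : Z → ℝ≥0∞) : ℝ≥0∞ :=
  ∫⁻ u in variationOnFromTo γ.toFun γ.dom γ.nonempty.some '' γ.dom,
    ρ (naturalParameterization γ.toFun γ.dom γ.nonempty.some u)

end MetricPath

/-- `ρ` is admissible for the path family `Γ`: a Borel function with integral at least `1` along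
every rectifiable path of `Γ`. -/
def IsModulusAdmissible {Z : Type*} [MetricSpace Z] [MeasurableSpace Z]
    (Γ : Set (MetricPath Z)) (ρ : Z → ℝ≥0∞) : Prop :=
  Measurable ρ ∧ ∀ γ ∈ Γ, γ.Rectifiable → 1 ≤ γ.lineIntegral ρ

/-- The `p`-modulus of a path family. -/
def pathModulus {Z : Type*} [MetricSpace Z] [MeasurableSpace Z]
    (μ : Measure Z) (p : ℝ) (Γ : Set (MetricPath Z)) : ℝ≥0∞ :=
  ⨅ (ρ : Z → ℝ≥0∞) (_ : IsModulusAdmissible Γ ρ), ∫⁻ z, ρ z ^ p ∂μ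

/-! ### Hyperbolic fillings and weak capacity -/

/-- The weak `ℓ^p`-norm: the infimum of all `C > 0` such that
`#{x : f x > t} ≤ C ^ p / t ^ p` for all `t > 0`. -/
def weakNorm {ι : Type*} (p : ℝ) (f : ι → ℝ≥0∞) : ℝ≥0∞ :=
  ⨅ (C : ℝ≥0) (_ : 0 < C ∧ ∀ t : ℝ≥0, 0 < t →
    ((Set.encard {x | (t : ℝ≥0∞) < f x} : ℕ∞) : ℝ≥0∞) ≤ (C : ℝ≥0∞) ^ p / (t : ℝ≥0∞) ^ p),
    (C : ℝ≥0∞)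

/-- The points of `P` have mutual distances at least `ε`. -/
def IsSeparatedSet {Z : Type*} [MetricSpace Z] (ε : ℝ) (P : Set Z) : Prop :=
  P.Pairwise fun x y => ε ≤ dist x y

/-- The data of a hyperbolic filling of `Z`: a parameter `s > 1`, a unit of length `R > diam Z`
(measuring distances in multiples of `R` is the rescaling that makes the diameter less than `1`),
and for each level `k` a maximal `R s⁻ᵏ`-separated set `centers k`. -/
structure HyperbolicFilling (Z : Type*) [MetricSpace Z] where
  s : ℝ
  one_lt_s : 1 < s
  R : ℝ
  diam_lt : Metric.ediam (univ : Set Z) < ENNReal.ofReal R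
  centers : ℕ → Set Z
  maximal_centers : ∀ k, Maximal (IsSeparatedSet (R * s⁻¹ ^ k)) (centers k)

namespace HyperbolicFilling

variable {Z : Type*} [MetricSpace Z] (X : HyperbolicFilling Z)

/-- Vertices: the disjoint union over the levels `k` of the sets of centers of level `k`. -/
def Vertex : Type _ := Σ k : ℕ, X.centers k

variable {X}

/-- The level of a vertex. -/
def Vertex.level (v : X.Vertex) : ℕ := v.1

/-- The center of the ball of a vertex. -/
def Vertex.center (v : X.Vertex) : Z := v.2.1

/-- The radius `2 R s⁻ᵏ` of the ball of a vertex of level `k`. -/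
def Vertex.radius (v : X.Vertex) : ℝ := 2 * (X.R * X.s⁻¹ ^ v.level)

/-- The ball of a vertex. -/
def Vertex.ball (v : X.Vertex) : Set Z := Metric.ball v.center v.radius

variable (X)

/-- Distinct vertices are joined by an edge if their levels differ by at most one and the closures
of their balls intersect. -/
def graph : SimpleGraph X.Vertex where
  Adj v w := v ≠ w ∧ v.level ≤ w.level + 1 ∧ w.level ≤ v.level + 1 ∧
    (closure v.ball ∩ closure w.ball).Nonempty
  symm := ⟨fun v w h => ⟨h.1.symm, h.2.2.1, h.2.1, by rw [inter_comm]; exact h.2.2.2⟩⟩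
  loopless := ⟨fun _ h => h.1 rfl⟩

variable {X}

/-- Nontangential convergence of a sequence of vertices to a point of `Z`. -/
def TendstoNontangentially (v : ℕ → X.Vertex) (z : Z) : Prop :=
  Tendsto (fun n => (v n).center) atTop (𝓝 z) ∧
    Tendsto (fun n => (v n).radius) atTop (𝓝 0) ∧
      ∃ C : ℝ, 0 < C ∧ ∀ n, dist z (v n).center ≤ C * (v n).radius

variable (X)

/-- `τ` is admissible for `A` and `B`: every infinite path in the filling, one of whose ends has a
nontangential limit in `A` and the other one in `B`, has `τ`-length at least `1`. -/
def IsAdmissible (A B : Set Z) (τ : X.graph.edgeSet → ℝ≥0∞) : Prop :=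
  ∀ (v : ℤ → X.Vertex) (hv : ∀ k, X.graph.Adj (v k) (v (k + 1))),
    ∀ a ∈ A, ∀ b ∈ B,
      TendstoNontangentially (fun n : ℕ => v (-(n : ℤ))) a →
      TendstoNontangentially (fun n : ℕ => v (n : ℤ)) b →
        1 ≤ ∑' k : ℤ, τ ⟨s(v k, v (k + 1)), hv k⟩

/-- The weak `p`-capacity between `A` and `B`. -/
def wcap (p : ℝ) (A B : Set Z) : ℝ≥0∞ :=
  ⨅ (τ : X.graph.edgeSet → ℝ≥0∞) (_ : X.IsAdmissible A B τ), weakNorm p τ ^ p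

/-- The critical exponent `Q_w`: the infimum of all `p > 0` such that the weak `p`-capacity between
any two open sets at positive distance is finite. -/
def Qw : ℝ≥0∞ :=
  ⨅ (p : ℝ) (_ : 0 < p ∧ ∀ A B : Set Z, IsOpen A → IsOpen B → 0 < setDist A B →
    X.wcap p A B < ∞), ENNReal.ofReal p

end HyperbolicFilling

end

/-! ### Ahlfors regular measures on compact spaces -/

section Ahlfors

variable {Z : Type*} [MetricSpace Z] [CompactSpace Z]

/-! Two estimates meet at the exponent `Q`.

Finiteness above the dimension. Let `f` be a quasisymmetric bijection of `Z` onto an Ahlfors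
`Q'`-regular space and let `q > Q'`. Weighting each edge by the distance between the images of its
two centers gives, up to a constant factor, an admissible function for sets at positive distance, by
the triangle inequality. The `Q'`-th powers of these weights are dominated by the masses of image
sets that are disjoint on each level, and the `(q - Q')`-th powers decay geometrically in the level
because `f` is Hölder continuous. Hence the weights lie in `ℓ^q` and the weak capacity is finite
(`wcap_lt_top_of_isQuasisymmetry`).

Infinity below `Q`. Let `τ` be admissible for open `A`, `B` at positive distance and of finite weak
`ℓ^q` norm with `q < Q`. Its suprema over the edges at a vertex are again of weak type, hence in
`ℓ^Q`; spreading those of level `n` over balls gives densities `ρ n` whose `Q`-energies are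
summable. A rectifiable path meeting `A` and `B` is shadowed by a bi-infinite path of the filling:
it comes from a point of `A` to level `n`, follows the path horizontally, and leaves towards a point
of `B`. By a Borel–Cantelli argument the endpoints at which a vertical part may fail to be summable
are too few to fill a piece of the path, so good endpoints exist in the open sets. For large `n` the
vertical parts then cost at most `1 / 2` together, and the horizontal part, bounded by the line
integral of `ρ n`, costs at least `1 / 2`. Suprema of tails of `2 * ρ n` are therefore admissible
with arbitrarily small energy, and the `Q`-modulus of the paths meeting both sets is zero
(`pathModulus_eq_zero_of_wcap_ne_top`).

Conclusion. As `μ` is finite, positive `p`-modulus forces positive `Q`-modulus, and countable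
subadditivity concentrates it on the paths joining two balls at positive distance. For these balls
the weak capacity is infinite below `Q`. The identity map bounds both critical numbers by `Q` from
above; an admissible metric of exponent `Q' < Q` would make the capacity finite for `q` between `Q'`
and `Q`. -/

theorem ediam_univ_eq_ofReal_diam :
    Metric.ediam (univ : Set Z) = ENNReal.ofReal (Metric.diam (univ : Set Z)) := by
  rw [Metric.diam, ENNReal.ofReal_toReal isCompact_univ.isBounded.ediam_ne_top]

theorem diam_univ_pos [Nontrivial Z] : 0 < Metric.diam (univ : Set Z) :=
  Metric.diam_pos nontrivial_univ isCompact_univ.isBounded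

variable [MeasurableSpace Z] {μ : Measure Z} {Q : ℝ}

theorem IsAhlforsRegular.isFiniteMeasure [Nontrivial Z] (hμ : IsAhlforsRegular μ Q) :
    IsFiniteMeasure μ := by
  obtain ⟨c, C, -, -, h⟩ := hμ
  refine ⟨isCompact_univ.measure_lt_top_of_nhdsWithin fun x _ =>
    ⟨Metric.ball x (Metric.diam (univ : Set Z)), ?_, ?_⟩⟩
  · exact mem_nhdsWithin_of_mem_nhds (Metric.ball_mem_nhds _ diam_univ_pos)
  · exact (h x _ diam_univ_pos ediam_univ_eq_ofReal_diam.ge).2.trans_lt ENNReal.ofReal_lt_top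

theorem IsAhlforsRegular.measure_univ_pos [Nontrivial Z] (hμ : IsAhlforsRegular μ Q) :
    0 < μ univ := by
  obtain ⟨c, C, hc, -, h⟩ := hμ
  obtain ⟨z⟩ : Nonempty Z := inferInstance
  have hD : 0 < Metric.diam (univ : Set Z) := diam_univ_pos
  refine lt_of_lt_of_le ?_ ((h z _ hD ediam_univ_eq_ofReal_diam.ge).1.trans
    (measure_mono (subset_univ _)))
  exact ENNReal.ofReal_pos.2 (by positivity)

/-- The upper mass bound of an Ahlfors regular measure holds at all scales. -/
theorem IsAhlforsRegular.exists_measure_ball_le [Nontrivial Z] (hQ : 0 < Q)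
    (hμ : IsAhlforsRegular μ Q) :
    ∃ C : ℝ, 0 < C ∧ ∀ (z : Z) (r : ℝ), 0 < r →
      μ (Metric.ball z r) ≤ ENNReal.ofReal (C * r ^ Q) := by
  have hfin := hμ.isFiniteMeasure
  obtain ⟨c, C, -, hC, h⟩ := hμ
  have hD : 0 < Metric.diam (univ : Set Z) := diam_univ_pos
  set D := Metric.diam (univ : Set Z) with hDdef
  have hDQ : 0 < D ^ Q := Real.rpow_pos_of_pos hD _
  refine ⟨max C (μ.real univ / D ^ Q), lt_max_of_lt_left hC, fun z r hr => ?_⟩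
  rcases le_or_gt r D with hrD | hrD
  · refine (h z r hr ?_).2.trans (ENNReal.ofReal_le_ofReal ?_)
    · rw [ediam_univ_eq_ofReal_diam]; exact ENNReal.ofReal_le_ofReal hrD
    · gcongr; exact le_max_left _ _
  · calc μ (Metric.ball z r) ≤ μ univ := measure_mono (subset_univ _)
      _ = ENNReal.ofReal (μ.real univ) := by simp
      _ ≤ _ := by
        refine ENNReal.ofReal_le_ofReal ?_
        calc μ.real univ = μ.real univ / D ^ Q * D ^ Q := by field_simp
          _ ≤ max C (μ.real univ / D ^ Q) * r ^ Q := by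
            gcongr
            exact le_max_right _ _

/-- The lower mass bound of an Ahlfors regular measure holds at all bounded scales. -/
theorem IsAhlforsRegular.exists_le_measure_ball [Nontrivial Z] (hQ : 0 < Q)
    (hμ : IsAhlforsRegular μ Q) {R : ℝ} (hR : 0 < R) :
    ∃ c : ℝ, 0 < c ∧ ∀ (z : Z) (r : ℝ), 0 < r → r ≤ R →
      ENNReal.ofReal (c * r ^ Q) ≤ μ (Metric.ball z r) := by
  obtain ⟨c, C, hc, -, h⟩ := hμ
  have hD : 0 < Metric.diam (univ : Set Z) := diam_univ_pos
  set D := Metric.diam (univ : Set Z) with hDdef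
  -- For radii between `D` and `R` only the mass `c * D ^ Q` is available; it equals `c * (D / R) ^
  -- Q * R ^ Q`.
  refine ⟨c * min 1 ((D / R) ^ Q), by positivity, fun z r hr hrR => ?_⟩
  rcases le_or_gt r D with hrD | hrD
  · refine le_trans (ENNReal.ofReal_le_ofReal ?_) (h z r hr ?_).1
    · gcongr
      exact mul_le_of_le_one_right hc.le (min_le_left _ _)
    · rw [ediam_univ_eq_ofReal_diam]; exact ENNReal.ofReal_le_ofReal hrD
  · refine le_trans (ENNReal.ofReal_le_ofReal ?_) ((h z D hD ?_).1.trans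
      (measure_mono (Metric.ball_subset_ball hrD.le)))
    · calc c * min 1 ((D / R) ^ Q) * r ^ Q ≤ c * (D / R) ^ Q * R ^ Q := by
            gcongr
            exact min_le_right _ _
        _ = c * D ^ Q := by
          rw [mul_assoc, ← Real.mul_rpow (by positivity) hR.le, div_mul_cancel₀ _ hR.ne']
    · rw [ediam_univ_eq_ofReal_diam]

/-- In an Ahlfors regular space, separated sets in balls of comparable radius have a uniformly
bounded number of elements. -/
theorem IsAhlforsRegular.exists_encard_le [Nontrivial Z] [OpensMeasurableSpace Z] (hQ : 0 < Q)
    (hμ : IsAhlforsRegular μ Q) {R K : ℝ} (hR : 0 < R) (hK : 0 < K) :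
    ∃ M : ℕ, ∀ ε : ℝ, 0 < ε → ε ≤ R → ∀ P : Set Z, IsSeparatedSet ε P → ∀ z : Z,
      (P ∩ Metric.ball z (K * ε)).encard ≤ M := by
  obtain ⟨C, hC, hCb⟩ := hμ.exists_measure_ball_le hQ
  obtain ⟨c, hc, hcb⟩ := hμ.exists_le_measure_ball hQ hR
  -- Volume comparison: disjoint balls of radius `ε / 2` lie in one of radius `(K + 1) * ε`, and `2
  -- * (K + 1)` is the ratio of the radii.
  refine ⟨⌈C / c * (2 * (K + 1)) ^ Q⌉₊, fun ε hε hεR P hP z => ?_⟩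
  by_contra! hlt
  set M := ⌈C / c * (2 * (K + 1)) ^ Q⌉₊ with hM
  obtain ⟨t, ht, htc⟩ := exists_subset_encard_eq (Order.add_one_le_of_lt hlt)
  have htf : t.Finite := finite_of_encard_eq_coe (k := M + 1) (by simpa using htc)
  lift t to Finset Z using htf
  have hcard : t.card = M + 1 := by
    rw [encard_coe_eq_coe_finsetCard] at htc; exact_mod_cast htc
  have hdisj : (t : Set Z).PairwiseDisjoint fun x => Metric.ball x (ε / 2) := by
    intro x hx y hy hxy
    refine Metric.ball_disjoint_ball ?_
    have := hP (ht hx).1 (ht hy).1 hxy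
    linarith
  have h1 : ∑ x ∈ t, μ (Metric.ball x (ε / 2)) ≤ μ (Metric.ball z ((K + 1) * ε)) := by
    rw [← measure_biUnion_finset hdisj fun x _ => Metric.isOpen_ball.measurableSet]
    refine measure_mono (iUnion₂_subset fun x hx => Metric.ball_subset_ball' ?_)
    have := (ht hx).2
    rw [Metric.mem_ball] at this
    linarith
  have h2 : (t.card : ℝ≥0∞) * ENNReal.ofReal (c * (ε / 2) ^ Q) ≤
      ENNReal.ofReal (C * ((K + 1) * ε) ^ Q) := by
    refine le_trans ?_ (h1.trans (hCb _ _ (by positivity)))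
    rw [← nsmul_eq_mul]
    exact Finset.card_nsmul_le_sum _ _ _ fun x _ => hcb _ _ (by positivity) (by linarith)
  rw [← ENNReal.ofReal_natCast, ← ENNReal.ofReal_mul (by positivity),
    ENNReal.ofReal_le_ofReal_iff (by positivity), hcard,
    show (K + 1) * ε = (2 * (K + 1)) * (ε / 2) by ring,
    Real.mul_rpow (by positivity) (by positivity), ← mul_assoc, ← mul_assoc,
    mul_le_mul_iff_left₀ (by positivity)] at h2
  have h3 := Nat.le_ceil (C / c * (2 * (K + 1)) ^ Q)
  rw [← hM, div_mul_eq_mul_div, div_le_iff₀ hc] at h3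
  push_cast at h2
  nlinarith

end Ahlfors

/-! ### Hyperbolic fillings -/

theorem exists_maximal_isSeparatedSet {Z : Type*} [MetricSpace Z] (ε : ℝ) :
    ∃ P : Set Z, Maximal (IsSeparatedSet ε) P := by
  refine zorn_subset {P : Set Z | IsSeparatedSet ε P} fun c hc hchain => ?_
  refine ⟨⋃₀ c, ?_, fun s hs => subset_sUnion_of_mem hs⟩
  rintro x ⟨s, hs, hxs⟩ y ⟨t, ht, hyt⟩ hxy
  rcases hchain.total hs ht with h | h
  · exact hc ht (h hxs) hyt hxy
  · exact hc hs hxs (h hyt) hxy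

theorem exists_hyperbolicFilling (Z : Type*) [MetricSpace Z] [CompactSpace Z] :
    Nonempty (HyperbolicFilling Z) := by
  choose P hP using fun k : ℕ =>
    exists_maximal_isSeparatedSet (Z := Z) ((Metric.diam (univ : Set Z) + 1) * (2 : ℝ)⁻¹ ^ k)
  refine ⟨⟨2, one_lt_two, Metric.diam (univ : Set Z) + 1, ?_, P, hP⟩⟩
  rw [ediam_univ_eq_ofReal_diam,
    ENNReal.ofReal_lt_ofReal_iff (by linarith [Metric.diam_nonneg (s := (univ : Set Z))])]
  exact lt_add_one _

namespace HyperbolicFilling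

variable {Z : Type*} [MetricSpace Z] (X : HyperbolicFilling Z)

theorem s_pos : 0 < X.s := one_pos.trans X.one_lt_s

theorem R_pos : 0 < X.R := ENNReal.ofReal_pos.1 (bot_le.trans_lt X.diam_lt)

theorem dist_lt_R (x y : Z) : dist x y < X.R := by
  have h : edist x y < ENNReal.ofReal X.R :=
    (Metric.edist_le_ediam_of_mem (mem_univ x) (mem_univ y)).trans_lt X.diam_lt
  rwa [edist_dist, ENNReal.ofReal_lt_ofReal_iff X.R_pos] at h

/-- The mutual distance of the centers of level `k`. -/
noncomputable def mesh (k : ℕ) : ℝ := X.R * X.s⁻¹ ^ k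

theorem mesh_pos (k : ℕ) : 0 < X.mesh k :=
  mul_pos X.R_pos (pow_pos (inv_pos.2 X.s_pos) k)

theorem mesh_le (k : ℕ) : X.mesh k ≤ X.R :=
  mul_le_of_le_one_right X.R_pos.le
    (pow_le_one₀ (inv_pos.2 X.s_pos).le (inv_le_one_of_one_le₀ X.one_lt_s.le))

theorem mesh_antitone : Antitone X.mesh := fun _ _ h =>
  mul_le_mul_of_nonneg_left (pow_le_pow_of_le_one (inv_pos.2 X.s_pos).le
    (inv_le_one_of_one_le₀ X.one_lt_s.le) h) X.R_pos.le

theorem mesh_succ (k : ℕ) : X.mesh k = X.s * X.mesh (k + 1) := by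
  have := X.s_pos
  rw [mesh, mesh, pow_succ]
  field_simp

theorem tendsto_mesh : Tendsto X.mesh atTop (𝓝 0) := by
  have := (tendsto_pow_atTop_nhds_zero_of_lt_one (inv_pos.2 X.s_pos).le
    (inv_lt_one_of_one_lt₀ X.one_lt_s)).const_mul X.R
  rwa [mul_zero] at this

theorem isSeparatedSet_centers (k : ℕ) : IsSeparatedSet (X.mesh k) (X.centers k) :=
  (X.maximal_centers k).prop

/-- By maximality: a point at distance at least the mesh from all centers could be added to them. -/
theorem exists_center_dist_lt (k : ℕ) (z : Z) : ∃ x ∈ X.centers k, dist z x < X.mesh k := by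
  by_contra! h
  have hz : z ∉ X.centers k := fun hz => by
    have := h z hz
    rw [dist_self] at this
    exact (X.mesh_pos k).not_ge this
  refine hz ((X.maximal_centers k).le_of_ge (y := insert z (X.centers k)) ?_
    (subset_insert _ _) (mem_insert _ _))
  refine (X.isSeparatedSet_centers k).insert fun y hy _ => ⟨h y hy, ?_⟩
  rw [dist_comm]
  exact h y hy

theorem Vertex.radius_eq {X : HyperbolicFilling Z} (v : X.Vertex) :
    v.radius = 2 * X.mesh v.level := rfl

theorem Vertex.radius_pos {X : HyperbolicFilling Z} (v : X.Vertex) : 0 < v.radius := by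
  rw [v.radius_eq]; exact mul_pos two_pos (X.mesh_pos _)

theorem exists_vertex_mem_ball (k : ℕ) (z : Z) :
    ∃ v : X.Vertex, v.level = k ∧ dist z v.center < X.mesh k := by
  obtain ⟨x, hx, h⟩ := X.exists_center_dist_lt k z
  exact ⟨⟨k, x, hx⟩, rfl, h⟩

theorem Vertex.ext_center {X : HyperbolicFilling Z} {v w : X.Vertex} (h : v.level = w.level)
    (h' : v.center = w.center) : v = w := by
  obtain ⟨k, x⟩ := v
  obtain ⟨l, y⟩ := w
  obtain rfl : k = l := h
  congr 1
  exact Subtype.ext h'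

theorem dist_center_le_of_adj {X : HyperbolicFilling Z} {v w : X.Vertex} (h : X.graph.Adj v w) :
    dist v.center w.center ≤ v.radius + w.radius := by
  obtain ⟨z, hz, hz'⟩ := h.2.2.2
  have h1 := Metric.closure_ball_subset_closedBall hz
  have h2 := Metric.closure_ball_subset_closedBall hz'
  rw [Metric.mem_closedBall] at h1 h2
  exact (dist_triangle_left _ _ z).trans (add_le_add h1 h2)

theorem adj_of_mem_ball {X : HyperbolicFilling Z} {v w : X.Vertex} {z : Z} (hne : v ≠ w)
    (h : v.level ≤ w.level + 1) (h' : w.level ≤ v.level + 1) (hv : z ∈ v.ball) (hw : z ∈ w.ball) :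
    X.graph.Adj v w :=
  ⟨hne, h, h', z, subset_closure hv, subset_closure hw⟩

section Count

variable [CompactSpace Z] [Nontrivial Z] [MeasurableSpace Z] [OpensMeasurableSpace Z]
  {μ : Measure Z} {Q : ℝ}

theorem exists_encard_vertex_le (hQ : 0 < Q) (hμ : IsAhlforsRegular μ Q) {K : ℝ} (hK : 0 < K) :
    ∃ M : ℕ, ∀ (k : ℕ) (z : Z),
      {v : X.Vertex | v.level = k ∧ dist v.center z < K * X.mesh k}.encard ≤ M := by
  obtain ⟨M, hM⟩ := hμ.exists_encard_le hQ X.R_pos hK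
  refine ⟨M, fun k z => le_trans ?_ (hM _ (X.mesh_pos k) (X.mesh_le k) _
    (X.isSeparatedSet_centers k) z)⟩
  refine Set.encard_le_encard_of_injOn (f := Vertex.center) ?_ ?_
  · rintro ⟨l, x⟩ ⟨rfl, h⟩
    exact ⟨x.2, h⟩
  · rintro v ⟨hv, -⟩ w ⟨hw, -⟩ h
    exact Vertex.ext_center (hv.trans hw.symm) h

theorem finite_level (hQ : 0 < Q) (hμ : IsAhlforsRegular μ Q) (k : ℕ) :
    {v : X.Vertex | v.level = k}.Finite := by
  obtain ⟨z⟩ : Nonempty Z := inferInstance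
  have hm := X.mesh_pos k
  obtain ⟨M, hM⟩ := X.exists_encard_vertex_le hQ hμ (K := X.R / X.mesh k)
    (div_pos X.R_pos hm)
  refine finite_of_encard_le_coe (k := M) ((encard_le_encard ?_).trans (hM k z))
  intro v hv
  refine ⟨hv, ?_⟩
  rw [div_mul_cancel₀ _ hm.ne']
  exact X.dist_lt_R _ _

theorem countable_vertex (hQ : 0 < Q) (hμ : IsAhlforsRegular μ Q) : Countable X.Vertex := by
  refine countable_univ_iff.1
    ((countable_iUnion fun k => (X.finite_level hQ hμ k).countable).mono ?_)
  exact fun v _ => mem_iUnion.2 ⟨v.level, rfl⟩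

end Count

end HyperbolicFilling

/-! ### The Hausdorff dimension of an Ahlfors regular space -/

section Dimension

variable {Z : Type*} [MetricSpace Z] [CompactSpace Z] [Nontrivial Z] [MeasurableSpace Z]
  [BorelSpace Z] {μ : Measure Z} {Q : ℝ}

/-- Mass distribution principle: the upper mass bound makes a multiple of `μ` a lower bound for the
Hausdorff measure. -/
theorem IsAhlforsRegular.le_dimH (hQ : 0 < Q) (hμ : IsAhlforsRegular μ Q) :
    ENNReal.ofReal Q ≤ dimH (univ : Set Z) := by
  obtain ⟨C, hC, hCb⟩ := hμ.exists_measure_ball_le hQ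
  have key : ∀ s : Set Z, μ s ≤ ENNReal.ofReal C * Metric.ediam s ^ Q := by
    intro s
    rcases s.eq_empty_or_nonempty with rfl | ⟨x, hx⟩
    · simp
    have hs : Metric.ediam s = ENNReal.ofReal (Metric.diam s) := by
      rw [Metric.diam, ENNReal.ofReal_toReal (isCompact_univ.isBounded.subset
        (subset_univ s)).ediam_ne_top]
    have hd : 0 ≤ Metric.diam s := Metric.diam_nonneg
    rw [hs, ENNReal.ofReal_rpow_of_nonneg hd hQ.le, ← ENNReal.ofReal_mul hC.le]
    -- A set lies in the open ball of every radius `h > diam s` about each of its points; letting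
    -- `h` decrease to the diameter also covers one-point sets.
    have hcont : Tendsto (fun h : ℝ => ENNReal.ofReal (C * h ^ Q)) (𝓝[>] Metric.diam s)
        (𝓝 (ENNReal.ofReal (C * Metric.diam s ^ Q))) := by
      refine (ENNReal.continuous_ofReal.tendsto _).comp (tendsto_nhdsWithin_of_tendsto_nhds ?_)
      exact ((Real.continuousAt_rpow_const _ _ (Or.inr hQ.le)).tendsto).const_mul C
    refine ge_of_tendsto hcont (eventually_nhdsWithin_of_forall fun h hh => ?_)
    refine (measure_mono fun y hy => ?_).trans (hCb x h (hd.trans_lt hh))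
    exact (Metric.dist_le_diam_of_mem (isCompact_univ.isBounded.subset (subset_univ s)) hy
      hx).trans_lt hh
  have hC0 : ENNReal.ofReal C ≠ 0 := (ENNReal.ofReal_pos.2 hC).ne'
  have hle : (ENNReal.ofReal C)⁻¹ • μ ≤ μH[Q] := by
    refine Measure.le_hausdorffMeasure Q _ 1 one_pos fun s _ => ?_
    rw [Measure.smul_apply, smul_eq_mul]
    calc (ENNReal.ofReal C)⁻¹ * μ s
        ≤ (ENNReal.ofReal C)⁻¹ * (ENNReal.ofReal C * Metric.ediam s ^ Q) := by gcongr; exact key s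
      _ = Metric.ediam s ^ Q := by
        rw [← mul_assoc, ENNReal.inv_mul_cancel hC0 ENNReal.ofReal_ne_top, one_mul]
  refine le_dimH_of_hausdorffMeasure_ne_zero (d := Q.toNNReal) ?_
  rw [Real.coe_toNNReal _ hQ.le]
  refine (lt_of_lt_of_le ?_ (hle univ)).ne'
  rw [Measure.smul_apply, smul_eq_mul]
  exact ENNReal.mul_pos (ENNReal.inv_ne_zero.2 ENNReal.ofReal_ne_top) hμ.measure_univ_pos.ne'

/-- The balls about the centers of a level cover `Z`, and the concentric balls of half the radius
are disjoint, so their `Q`-sums are bounded by the total mass. -/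
theorem IsAhlforsRegular.dimH_le (hQ : 0 < Q) (hμ : IsAhlforsRegular μ Q) :
    dimH (univ : Set Z) ≤ ENNReal.ofReal Q := by
  have hfin := hμ.isFiniteMeasure
  obtain ⟨X⟩ := exists_hyperbolicFilling Z
  obtain ⟨c, hc, hcb⟩ := hμ.exists_le_measure_ball hQ X.R_pos
  have : ∀ k, Countable (X.centers k) := fun k => by
    refine Set.Countable.to_subtype ?_
    refine ((X.finite_level hQ hμ k).image HyperbolicFilling.Vertex.center).countable.mono ?_
    exact fun x hx => ⟨⟨k, x, hx⟩, rfl, rfl⟩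
  have hbound : ∀ k, ∑' x : X.centers k, Metric.ediam (Metric.ball (x : Z) (X.mesh k)) ^ Q ≤
      ENNReal.ofReal (4 ^ Q / c) * μ univ := by
    intro k
    have hm := X.mesh_pos k
    have hsum : ∑' x : X.centers k, μ (Metric.ball (x : Z) (X.mesh k / 2)) ≤ μ univ := by
      refine (tsum_meas_le_meas_iUnion_of_disjoint μ (fun x => Metric.isOpen_ball.measurableSet)
        ?_).trans (measure_mono (subset_univ _))
      intro x y hxy
      refine Metric.ball_disjoint_ball ?_
      have := X.isSeparatedSet_centers k x.2 y.2 (fun h => hxy (Subtype.ext h))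
      linarith
    refine le_trans ?_ (mul_le_mul_right hsum _)
    rw [← ENNReal.tsum_mul_left]
    refine ENNReal.tsum_le_tsum fun x => ?_
    calc Metric.ediam (Metric.ball (x : Z) (X.mesh k)) ^ Q
        ≤ ENNReal.ofReal (2 * X.mesh k) ^ Q := by
          refine ENNReal.rpow_le_rpow (Metric.ediam_le_of_forall_dist_le fun y hy z hz => ?_) hQ.le
          rw [Metric.mem_ball] at hy hz
          linarith [dist_triangle_right y z (x : Z)]
      _ = ENNReal.ofReal (4 ^ Q / c) * ENNReal.ofReal (c * (X.mesh k / 2) ^ Q) := by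
          rw [ENNReal.ofReal_rpow_of_nonneg (by positivity) hQ.le,
            ← ENNReal.ofReal_mul (by positivity), ← mul_assoc, div_mul_cancel₀ _ hc.ne',
            ← Real.mul_rpow (by positivity) (by positivity)]
          ring_nf
      _ ≤ _ := by
          gcongr
          exact hcb _ _ (by positivity) (by linarith [X.mesh_le k])
  refine dimH_le_of_hausdorffMeasure_ne_top (d := Q.toNNReal) ?_
  rw [Real.coe_toNNReal _ hQ.le]
  have hr : Tendsto (fun k => ENNReal.ofReal (2 * X.mesh k)) atTop (𝓝 0) := by
    have := ENNReal.tendsto_ofReal (X.tendsto_mesh.const_mul 2)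
    simpa using this
  have hH := Measure.hausdorffMeasure_le_liminf_tsum Q (univ : Set Z) _ hr
    (fun k (x : X.centers k) => Metric.ball (x : Z) (X.mesh k))
    (Eventually.of_forall fun k x => by
      refine Metric.ediam_le_of_forall_dist_le fun y hy z hz => ?_
      rw [Metric.mem_ball] at hy hz
      linarith [dist_triangle_right y z (x : Z)])
    (Eventually.of_forall fun k z _ => by
      obtain ⟨x, hx, hzx⟩ := X.exists_center_dist_lt k z
      exact mem_iUnion.2 ⟨⟨x, hx⟩, hzx⟩)
  refine ne_top_of_le_ne_top (ENNReal.mul_ne_top (b := μ univ)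
    (ENNReal.ofReal_ne_top (r := 4 ^ Q / c)) (measure_ne_top _ _))
    (hH.trans ?_)
  exact (liminf_le_liminf (Eventually.of_forall hbound)).trans (by simp)

end Dimension

/-! ### Metric properties of quasisymmetries -/

section Quasisymmetry

variable {Z Y : Type*} [MetricSpace Z] [MetricSpace Y] {f : Z → Y}

theorem isQuasisymmetry_id (Z : Type*) [MetricSpace Z] : IsQuasisymmetry (id : Z → Z) :=
  ⟨Homeomorph.refl _, fun _ _ _ _ h => h⟩

theorem IsQuasisymmetry.exists_dist_le [CompactSpace Z] [Nontrivial Z] (hf : IsQuasisymmetry f) :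
    ∃ B : ℝ, 0 < B ∧ ∀ x y, dist (f x) (f y) ≤ B := by
  obtain ⟨η, hη⟩ := hf
  obtain ⟨p, q, hpq⟩ := exists_pair_ne Z
  have hpq' : 0 < dist p q := dist_pos.2 hpq
  set T : ℝ≥0 := (Metric.diam (univ : Set Z) / dist p q).toNNReal with hT
  have hp : ∀ x, dist (f p) (f x) ≤ η T * dist (f p) (f q) := fun x => by
    refine hη _ _ _ _ ?_
    rw [hT, Real.coe_toNNReal _ (div_nonneg Metric.diam_nonneg dist_nonneg),
      div_mul_cancel₀ _ hpq'.ne']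
    exact Metric.dist_le_diam_of_mem isCompact_univ.isBounded (mem_univ _) (mem_univ _)
  refine ⟨2 * (η T * dist (f p) (f q)) + 1, by positivity, fun x y => ?_⟩
  linarith [dist_triangle_left (f x) (f y) (f p), hp x, hp y]

theorem IsQuasisymmetry.exists_half_le (hf : IsQuasisymmetry f) :
    ∃ t : ℝ, 0 < t ∧ t < 1 ∧ ∀ x y z, dist x y ≤ t * dist x z →
      dist (f x) (f y) ≤ 1 / 2 * dist (f x) (f z) := by
  obtain ⟨η, hη⟩ := hf
  obtain ⟨t, ht, hηt⟩ : ∃ t : ℝ≥0, 0 < t ∧ η t ≤ 1 / 2 := by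
    -- That `η` fixes `0` need not be known: otherwise `t = η.symm 0` is positive and has value `0`.
    rcases eq_or_ne (η.symm 0) 0 with h0 | h0
    · have hη0 : η 0 = 0 := by simpa [h0] using η.apply_symm_apply 0
      have hev : ∀ᶠ t in 𝓝 (0 : ℝ≥0), η t < 1 / 2 := by
        refine η.continuous.continuousAt.eventually_lt continuousAt_const ?_
        rw [hη0]; positivity
      obtain ⟨t, h1, h2⟩ := ((hev.filter_mono nhdsWithin_le_nhds).and
        (self_mem_nhdsWithin (s := Ioi (0 : ℝ≥0)))).exists
      exact ⟨t, h2, h1.le⟩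
    · exact ⟨η.symm 0, pos_iff_ne_zero.2 h0, by simp⟩
  refine ⟨min t (1 / 2), by positivity, (min_le_right _ _).trans_lt (by norm_num),
    fun x y z h => ?_⟩
  refine (hη x y z t (h.trans ?_)).trans ?_
  · gcongr; exact min_le_left _ _
  · gcongr; exact_mod_cast hηt

/-- A quasisymmetry of a compact connected space is Hölder continuous. -/
theorem IsQuasisymmetry.exists_dist_le_rpow [CompactSpace Z] [ConnectedSpace Z] [Nontrivial Z]
    (hf : IsQuasisymmetry f) :
    ∃ C α : ℝ, 0 < C ∧ 0 < α ∧ ∀ x y, dist (f x) (f y) ≤ C * dist x y ^ α := by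
  obtain ⟨B, hB, hfB⟩ := hf.exists_dist_le
  obtain ⟨t, ht, ht1, hft⟩ := hf.exists_half_le
  obtain ⟨p, q, hpq⟩ := exists_pair_ne Z
  set r : ℝ := dist p q / 2 with hr
  have hr0 : 0 < r := half_pos (dist_pos.2 hpq)
  -- Connectedness enters here: small spheres are nonempty, so the contraction by `1 / 2` can be
  -- iterated through points at distances `t ^ k * r`.
  have hsphere : ∀ x : Z, ∀ ρ, 0 ≤ ρ → ρ ≤ r → ∃ z, dist x z = ρ := by
    intro x ρ hρ hρr
    obtain ⟨y, hy⟩ : ∃ y, r ≤ dist x y := by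
      by_contra! h
      linarith [h p, h q, dist_triangle_left p q x]
    have := intermediate_value_univ x y (f := fun z => dist x z) (by fun_prop)
    exact this ⟨by simpa using hρ, hρr.trans hy⟩
  have hiter : ∀ k : ℕ, ∀ x y, dist x y ≤ t ^ k * r → dist (f x) (f y) ≤ (1 / 2) ^ k * B := by
    intro k
    induction k with
    | zero => intro x y _; simpa using hfB x y
    | succ k ih =>
      intro x y h
      obtain ⟨z, hz⟩ := hsphere x (t ^ k * r) (by positivity)
        (mul_le_of_le_one_left hr0.le (pow_le_one₀ ht.le ht1.le))
      have h1 := hft x y z (by rw [hz]; linarith [pow_succ' t k ▸ h])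
      have h2 := ih x z hz.le
      rw [pow_succ']
      linarith
  have hlog : Real.log t < 0 := Real.log_neg ht ht1
  -- The exponent with `t ^ α = 1 / 2`, which turns halving per scale into a power of the distance.
  set α : ℝ := Real.log (1 / 2) / Real.log t with hα
  have hα0 : 0 < α := div_pos_of_neg_of_neg (Real.log_neg (by norm_num) (by norm_num)) hlog
  have htα : t ^ α = 1 / 2 := by
    rw [Real.rpow_def_of_pos ht, hα, mul_div_cancel₀ _ hlog.ne, Real.exp_log (by norm_num)]
  refine ⟨2 * B / r ^ α, α, by positivity, hα0, fun x y => ?_⟩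
  have hrew : 2 * B / r ^ α * dist x y ^ α = 2 * B * (dist x y / r) ^ α := by
    rw [Real.div_rpow dist_nonneg hr0.le]; ring
  rw [hrew]
  rcases eq_or_ne x y with rfl | hxy
  · rw [dist_self]; positivity
  have hd : 0 < dist x y := dist_pos.2 hxy
  rcases le_or_gt (dist x y / r) 1 with h1 | h1
  · obtain ⟨n, hn, hn'⟩ := exists_nat_pow_near_of_lt_one (div_pos hd hr0) h1 ht ht1
    calc dist (f x) (f y) ≤ (1 / 2) ^ n * B := hiter n x y ((div_le_iff₀ hr0).1 hn')
      _ = 2 * B * (t ^ (n + 1)) ^ α := by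
        rw [← Real.rpow_natCast t, ← Real.rpow_mul ht.le, mul_comm _ α, Real.rpow_mul ht.le, htα,
          Real.rpow_natCast, pow_succ]
        ring
      _ ≤ _ := by gcongr
  · have : 1 ≤ (dist x y / r) ^ α := Real.one_le_rpow h1.le hα0.le
    nlinarith [hfB x y]

/-- If `x` and `y` are `δ` apart, all of `Z` lies within `diam / δ` times their distance from `x`;
so the image of a fixed pair is controlled by `dist (f x) (f y)`. -/
theorem IsQuasisymmetry.exists_le_dist [CompactSpace Z] [Nontrivial Z]
    (hf : IsQuasisymmetry f) (hinj : Function.Injective f) {δ : ℝ} (hδ : 0 < δ) :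
    ∃ δ' : ℝ, 0 < δ' ∧ ∀ x y, δ ≤ dist x y → δ' ≤ dist (f x) (f y) := by
  obtain ⟨η, hη⟩ := hf
  obtain ⟨p, q, hpq⟩ := exists_pair_ne Z
  have hpq' : 0 < dist (f p) (f q) := dist_pos.2 (hinj.ne hpq)
  set T : ℝ≥0 := (Metric.diam (univ : Set Z) / δ).toNNReal with hT
  have hT0 : 0 ≤ Metric.diam (univ : Set Z) / δ := div_nonneg Metric.diam_nonneg hδ.le
  refine ⟨dist (f p) (f q) / (2 * η T + 1), by positivity, fun x y hxy => ?_⟩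
  have h : ∀ z, dist (f x) (f z) ≤ η T * dist (f x) (f y) := fun z => by
    refine hη _ _ _ _ ?_
    rw [hT, Real.coe_toNNReal _ hT0]
    calc dist x z ≤ Metric.diam (univ : Set Z) :=
          Metric.dist_le_diam_of_mem isCompact_univ.isBounded (mem_univ _) (mem_univ _)
      _ = Metric.diam (univ : Set Z) / δ * δ := by rw [div_mul_cancel₀ _ hδ.ne']
      _ ≤ _ := by gcongr
  rw [div_le_iff₀ (by positivity)]
  nlinarith [dist_triangle_left (f p) (f q) (f x), h p, h q, dist_nonneg (x := f x) (y := f y)]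

theorem IsQuasisymmetry.continuous [CompactSpace Z] [ConnectedSpace Z] [Nontrivial Z]
    (hf : IsQuasisymmetry f) : Continuous f := by
  obtain ⟨C, α, hC, hα, h⟩ := hf.exists_dist_le_rpow
  refine continuous_iff_continuousAt.2 fun x => tendsto_iff_dist_tendsto_zero.2 ?_
  refine squeeze_zero (fun _ => dist_nonneg) (fun y => h y x) ?_
  have h0 : Tendsto (fun y => dist y x) (𝓝 x) (𝓝 0) := tendsto_iff_dist_tendsto_zero.1 tendsto_id
  have := (h0.rpow_const (Or.inr hα.le) (p := α)).const_mul C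
  rwa [Real.zero_rpow hα.ne', mul_zero] at this

end Quasisymmetry

/-! ### Weak norms -/

/-- Chebyshev's inequality. The `+ 1` in the witness only ensures positivity. -/
theorem weakNorm_lt_top_of_tsum_ne_top {ι : Type*} {q : ℝ} (hq : 0 < q) {τ : ι → ℝ≥0∞}
    (h : ∑' e, τ e ^ q ≠ ∞) : weakNorm q τ < ∞ := by
  set S := ∑' e, τ e ^ q with hS
  have hS' : S ^ q⁻¹ ≠ ∞ := ENNReal.rpow_ne_top_of_nonneg (inv_pos.2 hq).le h
  refine (iInf₂_le ((S ^ q⁻¹).toNNReal + 1) ⟨by positivity, fun t ht => ?_⟩).trans_lt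
    ENNReal.coe_lt_top
  have ht0 : (t : ℝ≥0∞) ^ q ≠ 0 := by
    rw [Ne, ENNReal.rpow_eq_zero_iff]; simp [ht.ne', hq.not_gt]
  have htt : (t : ℝ≥0∞) ^ q ≠ ∞ := ENNReal.rpow_ne_top_of_nonneg hq.le ENNReal.coe_ne_top
  rw [ENNReal.le_div_iff_mul_le (Or.inl ht0) (Or.inl htt), ← ENNReal.tsum_set_const]
  calc ∑' _ : {x | (t : ℝ≥0∞) < τ x}, (t : ℝ≥0∞) ^ q
      ≤ ∑' x : {x | (t : ℝ≥0∞) < τ x}, τ x ^ q :=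
        ENNReal.tsum_le_tsum fun x => ENNReal.rpow_le_rpow x.2.le hq.le
    _ ≤ S := ENNReal.tsum_comp_le_tsum_of_injective Subtype.val_injective _
    _ = (S ^ q⁻¹) ^ q := by rw [← ENNReal.rpow_mul, inv_mul_cancel₀ hq.ne', ENNReal.rpow_one]
    _ ≤ _ := by
      refine ENNReal.rpow_le_rpow ?_ hq.le
      rw [ENNReal.coe_add, ENNReal.coe_toNNReal hS']
      exact le_self_add

theorem ENNReal.tsum_le_encard_mul {ι : Type*} {g : ι → ℝ≥0∞} {b : ℝ≥0∞} {S : Set ι} {N : ℕ}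
    (hS : S.encard ≤ N) (hg : ∀ i ∈ S, g i ≤ b) (hg0 : ∀ i ∉ S, g i = 0) :
    ∑' i, g i ≤ N * b := by
  calc ∑' i, g i ≤ ∑' i, S.indicator (fun _ => b) i := ENNReal.tsum_le_tsum fun i => by
        by_cases hi : i ∈ S
        · rw [indicator_of_mem hi]; exact hg i hi
        · rw [hg0 i hi]; exact zero_le
    _ = S.encard * b := by rw [← tsum_subtype, ENNReal.tsum_set_const]
    _ ≤ N * b := by
      gcongr
      calc ((S.encard : ℕ∞) : ℝ≥0∞) ≤ ((N : ℕ∞) : ℝ≥0∞) := ENat.toENNReal_le.2 hS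
        _ = N := by simp

/-! ### Finiteness of weak capacities above the dimension -/

theorem edist_le_tsum_edist {Y : Type*} [PseudoEMetricSpace Y] (u : ℤ → Y) (N : ℕ) :
    edist (u (-(N : ℤ))) (u N) ≤ ∑' k : ℤ, edist (u k) (u (k + 1)) := by
  have h1 := edist_le_range_sum_edist (fun j : ℕ => u (j - N)) (2 * N)
  have h2 : ∑ j ∈ Finset.range (2 * N), edist (u ((j : ℤ) - N)) (u (((j + 1 : ℕ) : ℤ) - N)) ≤
      ∑' j : ℕ, edist (u ((j : ℤ) - N)) (u ((j : ℤ) - N + 1)) := by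
    refine le_trans (Finset.sum_le_sum fun j _ => ?_) (ENNReal.sum_le_tsum _)
    rw [show ((j + 1 : ℕ) : ℤ) - N = (j : ℤ) - N + 1 by push_cast; ring]
  have h3 := ENNReal.tsum_comp_le_tsum_of_injective (f := fun j : ℕ => (j : ℤ) - N)
    (fun a b h => by simpa using h) fun k => edist (u k) (u (k + 1))
  simp only [Nat.cast_zero, zero_sub] at h1
  rw [show ((2 * N : ℕ) : ℤ) - N = N by push_cast; ring] at h1
  exact h1.trans (h2.trans h3)

namespace HyperbolicFilling

section

variable {Z Y : Type*} [MetricSpace Z] [MetricSpace Y] (X : HyperbolicFilling Z)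

/-- The distance in `Y` of the images of the centers of the end points of an edge. -/
noncomputable def edgeDist (f : Z → Y) (e : X.graph.edgeSet) : ℝ≥0∞ :=
  Sym2.lift ⟨fun v w : X.Vertex => edist (f v.center) (f w.center), fun _ _ => edist_comm _ _⟩ e.1

/-- Triangle inequality along finite pieces, passed to the limit at both ends. Only convergence of
the centers is used, not nontangentiality. -/
theorem isAdmissible_edgeDist_div {f : Z → Y} (hf : Continuous f) {A B : Set Z} {δ : ℝ≥0∞}
    (h0 : δ ≠ 0) (ht : δ ≠ ∞) (h : ∀ a ∈ A, ∀ b ∈ B, δ ≤ edist (f a) (f b)) :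
    X.IsAdmissible A B fun e => X.edgeDist f e / δ := by
  intro v hv a ha b hb hva hvb
  have hle : edist (f a) (f b) ≤ ∑' k : ℤ, edist (f (v k).center) (f (v (k + 1)).center) :=
    le_of_tendsto' (((hf.tendsto a).comp hva.1).edist ((hf.tendsto b).comp hvb.1)) fun N =>
      edist_le_tsum_edist (fun k => f (v k).center) N
  simp only [div_eq_mul_inv]
  rw [ENNReal.tsum_mul_right, ← div_eq_mul_inv, ENNReal.le_div_iff_mul_le (Or.inl h0) (Or.inl ht),
    one_mul]
  exact (h a ha b hb).trans hle

theorem dist_center_le_of_adj_of_level_le {v w : X.Vertex} (h : X.graph.Adj v w)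
    (hl : w.level ≤ v.level) : dist w.center v.center ≤ 4 * X.mesh w.level := by
  have h1 := dist_center_le_of_adj h.symm
  rw [v.radius_eq, w.radius_eq] at h1
  linarith [X.mesh_antitone hl]

theorem mesh_le_of_adj {v w : X.Vertex} (h : X.graph.Adj v w) :
    X.mesh w.level ≤ X.s * X.mesh v.level := by
  rcases lt_or_ge w.level v.level with hl | hl
  · have h2 : v.level = w.level + 1 := le_antisymm h.2.1 hl
    rw [h2, ← X.mesh_succ]
  · exact (X.mesh_antitone hl).trans
      (le_mul_of_one_le_left (X.mesh_pos _).le X.one_lt_s.le)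

theorem exists_encard_adj_le [CompactSpace Z] [Nontrivial Z] [MeasurableSpace Z]
    [OpensMeasurableSpace Z] {μ : Measure Z} {Q : ℝ} (hQ : 0 < Q) (hμ : IsAhlforsRegular μ Q) :
    ∃ M : ℕ, ∀ v : X.Vertex, {w | X.graph.Adj v w ∧ w.level ≤ v.level}.encard ≤ M := by
  obtain ⟨M, hM⟩ := X.exists_encard_vertex_le hQ hμ (K := 5) (by norm_num)
  refine ⟨M + M, fun v => ?_⟩
  push_cast
  -- For level `0` the truncated `v.level - 1` counts the same level again, which is harmless.
  refine le_trans ?_ (add_le_add (hM v.level v.center) (hM (v.level - 1) v.center))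
  refine (encard_le_encard ?_).trans (encard_union_le _ _)
  rintro w ⟨hw, hl⟩
  have hd : dist w.center v.center < 5 * X.mesh w.level := by
    linarith [X.dist_center_le_of_adj_of_level_le hw hl, X.mesh_pos w.level]
  rcases hl.lt_or_eq with hl | hl
  · have h2 : w.level = v.level - 1 := by have := hw.2.1; omega
    exact Or.inr ⟨h2, h2 ▸ hd⟩
  · exact Or.inl ⟨hl, hl ▸ hd⟩

/-- The sum over all edges is controlled by the sum over ordered pairs of vertices with the coarser
vertex in second place. -/
theorem tsum_edgeDist_rpow_le (f : Z → Y) (q : ℝ) :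
    ∑' e, X.edgeDist f e ^ q ≤ ∑' (v : X.Vertex) (w : X.Vertex),
      {w | X.graph.Adj v w ∧ w.level ≤ v.level}.indicator
        (fun w => edist (f v.center) (f w.center) ^ q) w := by
  have hex : ∀ e : X.graph.edgeSet, ∃ p : X.Vertex × X.Vertex, s(p.1, p.2) = e.1 ∧
      X.graph.Adj p.1 p.2 ∧ p.2.level ≤ p.1.level := by
    rintro ⟨e, he⟩
    induction e using Sym2.ind with
    | h v w =>
      rw [SimpleGraph.mem_edgeSet] at he
      rcases le_total v.level w.level with h | h
      · exact ⟨(w, v), Sym2.eq_swap, he.symm, h⟩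
      · exact ⟨(v, w), rfl, he, h⟩
  choose g hg hadj hlev using hex
  have hginj : Function.Injective g := fun e e' h => Subtype.ext (by rw [← hg e, ← hg e', h])
  rw [← ENNReal.tsum_prod]
  refine le_trans (ENNReal.tsum_le_tsum fun e => ?_)
    (ENNReal.tsum_comp_le_tsum_of_injective hginj _)
  rw [indicator_of_mem (show (g e).2 ∈ {w | X.graph.Adj (g e).1 w ∧ w.level ≤ (g e).1.level} from
    ⟨hadj e, hlev e⟩)]
  rw [edgeDist, ← hg e]
  rfl

/-- The image of the ball around the center of `v` whose radius is half the mesh contains a ball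
of radius comparable to the distances of the images of adjacent centers. -/
theorem exists_ball_subset_image {f : Z → Y} (hf : IsQuasisymmetry f)
    (hsurj : Function.Surjective f) :
    ∃ t : ℝ, 1 ≤ t ∧ ∀ v w : X.Vertex, X.graph.Adj v w → w.level ≤ v.level →
      Metric.ball (f v.center) (dist (f v.center) (f w.center) / t) ⊆
        f '' Metric.ball v.center (X.mesh v.level / 2) := by
  obtain ⟨η, hη⟩ := hf
  have hs := X.s_pos
  -- The centers are at most `4 * s` meshes of `v` apart, and `z` outside the half-mesh ball is at
  -- least half a mesh away: ratio `8 * s`.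
  refine ⟨max 1 (η (8 * X.s.toNNReal)), le_max_left _ _, fun v w hvw hl y hy => ?_⟩
  obtain ⟨z, rfl⟩ := hsurj y
  refine mem_image_of_mem f ?_
  by_contra hz
  rw [Metric.mem_ball, not_lt, dist_comm] at hz
  have h1 : dist v.center w.center ≤ ((8 * X.s.toNNReal : ℝ≥0) : ℝ) * dist v.center z := by
    rw [NNReal.coe_mul, Real.coe_toNNReal _ hs.le, dist_comm v.center w.center]
    have h2 := X.dist_center_le_of_adj_of_level_le hvw hl
    have h3 := X.mesh_le_of_adj hvw
    have h4 : X.s * (X.mesh v.level / 2) ≤ X.s * dist v.center z := by gcongr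
    push_cast
    linarith
  have h2 := hη _ _ _ _ h1
  rw [Metric.mem_ball, lt_div_iff₀ (by positivity), dist_comm] at hy
  have h3 : (η (8 * X.s.toNNReal) : ℝ) * dist (f v.center) (f z) ≤
      dist (f v.center) (f z) * max 1 ((η (8 * X.s.toNNReal) : ℝ≥0) : ℝ) := by
    rw [mul_comm]; gcongr; exact le_max_right _ _
  linarith

/-- Half-mesh balls about the centers of a level are disjoint, and so are their images; interiors
are taken to have measurable sets. -/
theorem tsum_measure_interior_image_le [MeasurableSpace Y] [BorelSpace Y] {f : Z → Y}
    (hinj : Function.Injective f) (ν : Measure Y) (k : ℕ) :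
    ∑' x : X.centers k, ν (interior (f '' Metric.ball (x : Z) (X.mesh k / 2))) ≤ ν univ := by
  refine (tsum_meas_le_meas_iUnion_of_disjoint ν (fun x => isOpen_interior.measurableSet)
    ?_).trans (measure_mono (subset_univ _))
  intro x y hxy
  refine Disjoint.mono interior_subset interior_subset ((disjoint_image_iff hinj).2 ?_)
  refine Metric.ball_disjoint_ball ?_
  have := X.isSeparatedSet_centers k x.2 y.2 (fun h => hxy (Subtype.ext h))
  linarith

/-- If `Z` is mapped quasisymmetrically onto an Ahlfors regular space, then the images of the edges
are summable to any power above the dimension of the image. -/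
theorem tsum_edgeDist_rpow_ne_top [CompactSpace Z] [ConnectedSpace Z] [Nontrivial Z]
    [MeasurableSpace Z] [OpensMeasurableSpace Z] {μ : Measure Z} {Q : ℝ} (hQ : 0 < Q)
    (hμ : IsAhlforsRegular μ Q) [MeasurableSpace Y] [BorelSpace Y] {ν : Measure Y} {Q' : ℝ}
    (hQ' : 0 < Q') (hν : IsAhlforsRegular ν Q') {f : Z → Y} (hf : IsQuasisymmetry f)
    (hbij : Function.Bijective f) {q : ℝ} (hq : Q' < q) :
    ∑' e, X.edgeDist f e ^ q ≠ ∞ := by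
  have : CompactSpace Y := ⟨by
    rw [← hbij.2.range_eq]; exact isCompact_range hf.continuous⟩
  have : Nontrivial Y := hbij.1.nontrivial
  have hνfin := hν.isFiniteMeasure
  obtain ⟨M, hM⟩ := X.exists_encard_adj_le hQ hμ
  obtain ⟨B, hB, hfB⟩ := hf.exists_dist_le
  obtain ⟨C, α, hC, hα, hfC⟩ := hf.exists_dist_le_rpow
  obtain ⟨t, ht, hft⟩ := X.exists_ball_subset_image hf hbij.2
  obtain ⟨c, hc, hcb⟩ := hν.exists_le_measure_ball hQ' hB
  have hs := X.s_pos
  have ht0 : 0 < t := one_pos.trans_le ht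
  have hqQ : 0 < q - Q' := sub_pos.2 hq
  set U : X.Vertex → Set Y := fun v => interior (f '' Metric.ball v.center (X.mesh v.level / 2))
    with hU
  set L : ℝ := C * (4 * X.s) ^ α with hL
  have hL0 : 0 < L := by positivity
  -- Split `q = (q - Q') + Q'`: Hölder continuity bounds the first factor by a power of the mesh,
  -- the lower mass bound turns the second into the mass of `U v`.
  have hmain : ∀ v w : X.Vertex, X.graph.Adj v w → w.level ≤ v.level →
      edist (f v.center) (f w.center) ^ q ≤
        ENNReal.ofReal ((L * X.mesh v.level ^ α) ^ (q - Q')) *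
          (ENNReal.ofReal (t ^ Q' / c) * ν (U v)) := by
    intro v w hvw hl
    have hm := X.mesh_pos v.level
    rcases eq_or_ne (f v.center) (f w.center) with h0 | h0
    · rw [h0, edist_self, ENNReal.zero_rpow_of_pos (by linarith)]
      exact zero_le
    have hd : 0 < dist (f v.center) (f w.center) := dist_pos.2 h0
    rw [edist_dist, show q = (q - Q') + Q' by ring,
      ENNReal.rpow_add _ _ (ENNReal.ofReal_pos.2 hd).ne' ENNReal.ofReal_ne_top,
      add_sub_cancel_right]
    refine mul_le_mul' ?_ ?_
    · rw [ENNReal.ofReal_rpow_of_pos hd]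
      refine ENNReal.ofReal_le_ofReal (Real.rpow_le_rpow hd.le ((hfC _ _).trans ?_) hqQ.le)
      rw [hL, mul_assoc, ← Real.mul_rpow (by positivity) hm.le, dist_comm]
      gcongr
      linarith [X.dist_center_le_of_adj_of_level_le hvw hl, X.mesh_le_of_adj hvw]
    · have hsub : Metric.ball (f v.center) (dist (f v.center) (f w.center) / t) ⊆ U v :=
        interior_maximal (hft v w hvw hl) Metric.isOpen_ball
      calc ENNReal.ofReal (dist (f v.center) (f w.center)) ^ Q'
          = ENNReal.ofReal (t ^ Q' / c) *
              ENNReal.ofReal (c * (dist (f v.center) (f w.center) / t) ^ Q') := by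
            rw [ENNReal.ofReal_rpow_of_pos hd, ← ENNReal.ofReal_mul (by positivity),
              Real.div_rpow hd.le ht0.le]
            congr 1
            field_simp
        _ ≤ _ := by
            gcongr
            refine (hcb _ _ (by positivity) ?_).trans (measure_mono hsub)
            exact (div_le_self hd.le ht).trans (hfB _ _)
  have hvertex : ∀ v : X.Vertex, ∑' w, {w | X.graph.Adj v w ∧ w.level ≤ v.level}.indicator
      (fun w => edist (f v.center) (f w.center) ^ q) w ≤
        M * (ENNReal.ofReal ((L * X.mesh v.level ^ α) ^ (q - Q')) *
          (ENNReal.ofReal (t ^ Q' / c) * ν (U v))) := by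
    intro v
    refine ENNReal.tsum_le_encard_mul (hM v) (fun w hw => ?_) fun w hw => indicator_of_notMem hw _
    rw [indicator_of_mem hw]
    exact hmain v w hw.1 hw.2
  have hlevel : ∀ k, ∑' x : X.centers k, (M * (ENNReal.ofReal ((L * X.mesh k ^ α) ^ (q - Q')) *
      (ENNReal.ofReal (t ^ Q' / c) *
        ν (interior (f '' Metric.ball (x : Z) (X.mesh k / 2)))))) ≤
        M * (ENNReal.ofReal ((L * X.mesh k ^ α) ^ (q - Q')) *
          (ENNReal.ofReal (t ^ Q' / c) * ν univ)) := by
    intro k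
    rw [ENNReal.tsum_mul_left, ENNReal.tsum_mul_left, ENNReal.tsum_mul_left]
    gcongr
    exact X.tsum_measure_interior_image_le hbij.1 ν k
  have hgeom : ∀ k, (L * X.mesh k ^ α) ^ (q - Q') =
      (L * X.R ^ α) ^ (q - Q') * (X.s⁻¹ ^ (α * (q - Q'))) ^ k := by
    intro k
    have hR := X.R_pos
    have hs' : 0 < X.s⁻¹ := inv_pos.2 hs
    rw [mesh, Real.mul_rpow hR.le (by positivity), ← mul_assoc,
      Real.mul_rpow (by positivity) (by positivity), ← Real.rpow_natCast, ← Real.rpow_natCast,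
      ← Real.rpow_mul hs'.le, ← Real.rpow_mul hs'.le, ← Real.rpow_mul hs'.le]
    ring_nf
  refine ne_top_of_le_ne_top ?_ ((X.tsum_edgeDist_rpow_le f q).trans
    (ENNReal.tsum_le_tsum hvertex))
  have hsig := ENNReal.tsum_sigma (β := fun k => X.centers k) fun k x =>
    (M * (ENNReal.ofReal ((L * X.mesh k ^ α) ^ (q - Q')) * (ENNReal.ofReal (t ^ Q' / c) *
      ν (interior (f '' Metric.ball (x : Z) (X.mesh k / 2))))) : ℝ≥0∞)
  refine ne_top_of_le_ne_top ?_ (hsig.le.trans (ENNReal.tsum_le_tsum hlevel))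
  rw [ENNReal.tsum_mul_left, ENNReal.tsum_mul_right]
  refine ENNReal.mul_ne_top (ENNReal.natCast_ne_top M) (ENNReal.mul_ne_top ?_
    (ENNReal.mul_ne_top ENNReal.ofReal_ne_top (measure_ne_top _ _)))
  simp only [hgeom]
  refine Summable.tsum_ofReal_ne_top ?_
  refine (summable_geometric_of_lt_one (by positivity) ?_).mul_left _
  exact Real.rpow_lt_one (inv_pos.2 hs).le (inv_lt_one_of_one_lt₀ X.one_lt_s) (by positivity)

theorem wcap_lt_top_of_isQuasisymmetry [CompactSpace Z] [ConnectedSpace Z] [Nontrivial Z]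
    [MeasurableSpace Z] [OpensMeasurableSpace Z] {μ : Measure Z} {Q : ℝ} (hQ : 0 < Q)
    (hμ : IsAhlforsRegular μ Q) [MeasurableSpace Y] [BorelSpace Y] {ν : Measure Y} {Q' : ℝ}
    (hQ' : 0 < Q') (hν : IsAhlforsRegular ν Q') {f : Z → Y} (hf : IsQuasisymmetry f)
    (hbij : Function.Bijective f) {q : ℝ} (hq : Q' < q) {A B : Set Z} (hAB : 0 < setDist A B) :
    X.wcap q A B < ∞ := by
  have hq0 : 0 < q := hQ'.trans hq
  obtain ⟨δ, hδ, hδAB⟩ : ∃ δ : ℝ, 0 < δ ∧ ENNReal.ofReal δ ≤ setDist A B := by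
    obtain ⟨δ, hδ, h⟩ := ENNReal.lt_iff_exists_nnreal_btwn.1 hAB
    exact ⟨δ, by exact_mod_cast hδ, by rw [ENNReal.ofReal_coe_nnreal]; exact h.le⟩
  obtain ⟨δ', hδ', h⟩ := hf.exists_le_dist hbij.1 hδ
  have hadm := X.isAdmissible_edgeDist_div hf.continuous (A := A) (B := B)
    (ENNReal.ofReal_pos.2 hδ').ne' ENNReal.ofReal_ne_top fun a ha b hb => by
      rw [edist_dist]
      refine ENNReal.ofReal_le_ofReal (h a b ?_)
      have h1 : ENNReal.ofReal δ ≤ edist a b := hδAB.trans (iInf₂_le_of_le a ha (iInf₂_le b hb))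
      rwa [edist_dist, ENNReal.ofReal_le_ofReal_iff dist_nonneg] at h1
  refine (iInf₂_le _ hadm).trans_lt (ENNReal.rpow_lt_top_of_nonneg hq0.le
    (weakNorm_lt_top_of_tsum_ne_top hq0 ?_).ne)
  simp only [div_eq_mul_inv, ENNReal.mul_rpow_of_nonneg _ _ hq0.le]
  rw [ENNReal.tsum_mul_right]
  refine ENNReal.mul_ne_top (X.tsum_edgeDist_rpow_ne_top hQ hμ hQ' hν hf hbij hq)
    (ENNReal.rpow_ne_top_of_nonneg hq0.le ?_)
  exact ENNReal.inv_ne_top.2 (ENNReal.ofReal_pos.2 hδ').ne'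

end

end HyperbolicFilling

/-! ### Line integrals along rectifiable paths -/

namespace MetricPath

variable {Z : Type*} [MetricSpace Z] (γ : MetricPath Z)

/-- The set of arclength parameters of a path. -/
noncomputable def arclengthSet : Set ℝ :=
  variationOnFromTo γ.toFun γ.dom γ.nonempty.some '' γ.dom

/-- The arclength parameterization of a path. -/
noncomputable def arclengthParam : ℝ → Z :=
  naturalParameterization γ.toFun γ.dom γ.nonempty.some

theorem lineIntegral_eq (ρ : Z → ℝ≥0∞) :
    γ.lineIntegral ρ = ∫⁻ u in γ.arclengthSet, ρ (γ.arclengthParam u) := rfl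

theorem lineIntegral_mono {ρ ρ' : Z → ℝ≥0∞} (h : ρ ≤ ρ') :
    γ.lineIntegral ρ ≤ γ.lineIntegral ρ' :=
  lintegral_mono fun _ => h _

theorem Nonconstant.nontrivial {γ : MetricPath Z} (h : γ.Nonconstant) : Nontrivial Z := by
  obtain ⟨t, -, t', -, h⟩ := h
  exact ⟨_, _, h⟩

theorem isPreconnected_image : IsPreconnected (γ.toFun '' γ.dom) :=
  γ.ordConnected.isPreconnected.image _ γ.continuousOn

theorem Icc_dist_subset (x : Z) {t t' : ℝ} (ht : t ∈ γ.dom) (ht' : t' ∈ γ.dom) :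
    Icc (dist x (γ.toFun t)) (dist x (γ.toFun t')) ⊆ (fun u => dist x (γ.toFun u)) '' γ.dom :=
  γ.ordConnected.isPreconnected.intermediate_value ht ht'
    ((continuous_const.dist continuous_id).comp_continuousOn γ.continuousOn)

/-- A path issuing from a point avoids, near this point, any set whose image under the distance
function from the point is a null set. -/
theorem exists_dist_lt_notMem {t t' : ℝ} (ht : t ∈ γ.dom) (ht' : t' ∈ γ.dom) {δ : ℝ} (hδ : 0 < δ)
    (hle : δ ≤ dist (γ.toFun t) (γ.toFun t')) {E : Set Z}
    (hE : volume ((fun z => dist (γ.toFun t) z) '' E) = 0) :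
    ∃ u ∈ γ.dom, dist (γ.toFun t) (γ.toFun u) < δ ∧ γ.toFun u ∉ E := by
  by_contra! h
  have hsub : Ico 0 δ ⊆ (fun z => dist (γ.toFun t) z) '' E := by
    intro r hr
    obtain ⟨u, hu, hur⟩ := γ.Icc_dist_subset (γ.toFun t) ht ht'
      (show r ∈ _ from ⟨by simpa using hr.1, hr.2.le.trans hle⟩)
    exact ⟨γ.toFun u, h u hu (hur.trans_lt hr.2), hur⟩
  have := (measure_mono hsub).trans_eq hE
  rw [Real.volume_Ico, sub_zero, nonpos_iff_eq_zero, ENNReal.ofReal_eq_zero] at this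
  exact hδ.not_ge this

variable {γ} (hγ : γ.Rectifiable)
include hγ

theorem Rectifiable.locallyBoundedVariationOn : LocallyBoundedVariationOn γ.toFun γ.dom :=
  BoundedVariationOn.locallyBoundedVariationOn hγ

theorem Rectifiable.measurableSet_arclengthSet : MeasurableSet γ.arclengthSet :=
  γ.ordConnected.measurableSet.image_of_monotoneOn
    (variationOnFromTo.monotoneOn hγ.locallyBoundedVariationOn γ.nonempty.some_mem)

theorem Rectifiable.exists_arclengthParam_eq {t : ℝ} (ht : t ∈ γ.dom) :
    ∃ u ∈ γ.arclengthSet, γ.arclengthParam u = γ.toFun t :=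
  ⟨_, mem_image_of_mem _ ht, edist_eq_zero.1
    (edist_naturalParameterization_eq_zero hγ.locallyBoundedVariationOn γ.nonempty.some_mem ht)⟩

theorem Rectifiable.lipschitzOnWith : LipschitzOnWith 1 γ.arclengthParam γ.arclengthSet := by
  have h := has_unit_speed_naturalParameterization γ.toFun hγ.locallyBoundedVariationOn
    γ.nonempty.some_mem
  have key : ∀ x ∈ γ.arclengthSet, ∀ y ∈ γ.arclengthSet, x ≤ y →
      edist (γ.arclengthParam x) (γ.arclengthParam y) ≤ edist x y := by
    intro x hx y hy hxy
    refine (eVariationOn.edist_le _ (s := γ.arclengthSet ∩ Icc x y) ⟨hx, le_rfl, hxy⟩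
      ⟨hy, hxy, le_rfl⟩).trans ((h hx hy).trans_le ?_)
    rw [edist_comm, edist_dist, Real.dist_eq, abs_of_nonneg (sub_nonneg.2 hxy)]
    simp
  intro x hx y hy
  rw [ENNReal.coe_one, one_mul]
  rcases le_total x y with hxy | hxy
  · exact key x hx y hy hxy
  · rw [edist_comm, edist_comm x]
    exact key y hy x hx hxy

theorem Rectifiable.aemeasurable_arclengthParam [MeasurableSpace Z] [BorelSpace Z] :
    AEMeasurable γ.arclengthParam (volume.restrict γ.arclengthSet) :=
  hγ.lipschitzOnWith.continuousOn.aemeasurable hγ.measurableSet_arclengthSet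

/-- A path meeting a ball and leaving the ball of twice the radius has length at least the radius
in the larger ball. -/
theorem Rectifiable.le_volume_preimage_ball {x : Z} {r : ℝ} {t t' : ℝ} (ht : t ∈ γ.dom)
    (ht' : t' ∈ γ.dom) (h : dist x (γ.toFun t) ≤ r) (h' : 2 * r ≤ dist x (γ.toFun t')) :
    ENNReal.ofReal r ≤ volume (γ.arclengthParam ⁻¹' Metric.ball x (2 * r) ∩ γ.arclengthSet) := by
  set E := γ.arclengthParam ⁻¹' Metric.ball x (2 * r) ∩ γ.arclengthSet with hE
  have hlip : LipschitzOnWith 1 (fun u => dist x (γ.arclengthParam u)) E := by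
    have h1 := (LipschitzWith.dist_right x).comp_lipschitzOnWith
      (hγ.lipschitzOnWith.mono (inter_subset_right
        (s := γ.arclengthParam ⁻¹' Metric.ball x (2 * r))))
    rwa [one_mul] at h1
  -- The distance from `x` takes all values in `[r, 2r)` on `E`, and a `1`-Lipschitz function does
  -- not increase length.
  have hsub : Ico r (2 * r) ⊆ (fun u => dist x (γ.arclengthParam u)) '' E := by
    intro ρ hρ
    obtain ⟨w, hw, hwρ⟩ := γ.Icc_dist_subset x ht ht'
      (show ρ ∈ _ from ⟨h.trans hρ.1, hρ.2.le.trans h'⟩)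
    obtain ⟨u, hu, huw⟩ := hγ.exists_arclengthParam_eq hw
    refine ⟨u, ⟨?_, hu⟩, ?_⟩
    · rw [mem_preimage, huw, Metric.mem_ball, dist_comm]
      exact hwρ.trans_lt hρ.2
    · simpa only [huw] using hwρ
  have hvol := hlip.hausdorffMeasure_image_le (d := 1) zero_le_one
  rw [hausdorffMeasure_real] at hvol
  have := (measure_mono hsub).trans hvol
  rw [Real.volume_Ico] at this
  simpa [two_mul] using this

/-- Each ball of `G` is met and its double is left, so the path has length at least `r` in the
double and collects at least `c i` there. -/
theorem Rectifiable.sum_le_lineIntegral [MeasurableSpace Z] [BorelSpace Z] {ι : Type*}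
    (F G : Finset ι) (hGF : G ⊆ F) (c : ι → ℝ≥0∞) (x : ι → Z) {r : ℝ} (hr : 0 < r)
    (hG : ∀ i ∈ G, (∃ t ∈ γ.dom, dist (x i) (γ.toFun t) ≤ r) ∧
      ∃ t ∈ γ.dom, 2 * r ≤ dist (x i) (γ.toFun t)) :
    ∑ i ∈ G, c i ≤ γ.lineIntegral fun z =>
      ∑ i ∈ F, (Metric.ball (x i) (2 * r)).indicator (fun _ => c i / ENNReal.ofReal r) z := by
  have hφ := hγ.aemeasurable_arclengthParam
  rw [lineIntegral_eq, lintegral_finsetSum']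
  · refine (Finset.sum_le_sum fun i hi => ?_).trans (Finset.sum_le_sum_of_subset hGF)
    obtain ⟨⟨t, ht, h⟩, t', ht', h'⟩ := hG i hi
    have hvol := hγ.le_volume_preimage_ball ht ht' h h'
    have hind : ∀ u, (Metric.ball (x i) (2 * r)).indicator (fun _ => c i / ENNReal.ofReal r)
        (γ.arclengthParam u) = (γ.arclengthParam ⁻¹' Metric.ball (x i) (2 * r)).indicator
          (fun _ => c i / ENNReal.ofReal r) u := fun u => rfl
    simp only [hind]
    rw [lintegral_indicator₀ (hφ.nullMeasurableSet_preimage Metric.isOpen_ball.measurableSet),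
      setLIntegral_const]
    calc c i = c i / ENNReal.ofReal r * ENNReal.ofReal r :=
          (ENNReal.div_mul_cancel (ENNReal.ofReal_pos.2 hr).ne' ENNReal.ofReal_ne_top).symm
      _ ≤ _ := by
          gcongr
          exact hvol.trans (Measure.le_restrict_apply _ _)
  · intro i _
    exact ((measurable_const.indicator Metric.isOpen_ball.measurableSet).comp_aemeasurable hφ)

end MetricPath

/-! ### Chains of vertices along connected sets -/

namespace HyperbolicFilling

variable {Z : Type*} [MetricSpace Z] (X : HyperbolicFilling Z)

/-- Two vertices of the same level whose balls meet a connected set are joined by a simple path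
through vertices of this level whose balls meet the set. -/
theorem exists_isPath_of_isPreconnected {E : Set Z} (hE : IsPreconnected E) {n : ℕ}
    {v w : X.Vertex} (hv : v.level = n) (hw : w.level = n) (hvE : (E ∩ v.ball).Nonempty)
    (hwE : (E ∩ w.ball).Nonempty) :
    ∃ p : X.graph.Walk v w, p.IsPath ∧
      ∀ u ∈ p.support, u.level = n ∧ (E ∩ u.ball).Nonempty := by
  classical
  set W : Set X.Vertex := {u | u.level = n ∧ (E ∩ u.ball).Nonempty} with hW
  set C : Set X.Vertex := {u | ∃ p : X.graph.Walk v u, ∀ x ∈ p.support, x ∈ W} with hC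
  have hvC : v ∈ C := ⟨.nil, fun x hx => by
    rw [SimpleGraph.Walk.support_nil, List.mem_singleton] at hx
    exact hx ▸ ⟨hv, hvE⟩⟩
  -- Otherwise the balls of reachable vertices and those of the other vertices of `W` are two open
  -- sets covering `E`; connectedness gives a common point, hence an edge between the two classes.
  have hwC : w ∈ C := by
    by_contra hwC
    have hopen : ∀ S : Set X.Vertex, IsOpen (⋃ u ∈ S, u.ball) := fun S =>
      isOpen_biUnion fun u _ => Metric.isOpen_ball
    have hcov : E ⊆ (⋃ u ∈ C, u.ball) ∪ ⋃ u ∈ W \ C, u.ball := by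
      intro z hz
      obtain ⟨u, hu, hzu⟩ := X.exists_vertex_mem_ball n z
      have hzu' : z ∈ u.ball := by
        rw [Vertex.ball, Metric.mem_ball, u.radius_eq, hu]
        linarith [X.mesh_pos n]
      by_cases huC : u ∈ C
      · exact Or.inl (mem_biUnion huC hzu')
      · exact Or.inr (mem_biUnion (show u ∈ W \ C from ⟨⟨hu, z, hz, hzu'⟩, huC⟩) hzu')
    obtain ⟨z, -, hz1, hz2⟩ := hE _ _ (hopen C) (hopen (W \ C)) hcov
      (hvE.mono (inter_subset_inter_right _ (subset_biUnion_of_mem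
        (u := fun u : X.Vertex => u.ball) hvC)))
      (hwE.mono (inter_subset_inter_right _ (subset_biUnion_of_mem (u := fun u : X.Vertex => u.ball)
        (show w ∈ W \ C from ⟨⟨hw, hwE⟩, hwC⟩))))
    obtain ⟨u, huC, hzu⟩ := mem_iUnion₂.1 hz1
    obtain ⟨u', hu', hzu'⟩ := mem_iUnion₂.1 hz2
    obtain ⟨p, hp⟩ := huC
    have hul : u.level = n := (hp u p.end_mem_support).1
    have hadj : X.graph.Adj u u' := adj_of_mem_ball
      (fun h => hu'.2 (h ▸ ⟨p, hp⟩)) (by rw [hul, hu'.1.1]; omega) (by rw [hul, hu'.1.1]; omega)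
      hzu hzu'
    refine hu'.2 ⟨p.concat hadj, fun x hx => ?_⟩
    rw [SimpleGraph.Walk.support_concat, List.mem_append, List.mem_singleton] at hx
    rcases hx with hx | rfl
    · exact hp x hx
    · exact hu'.1
  obtain ⟨p, hp⟩ := hwC
  exact ⟨p.bypass, p.bypass_isPath, fun u hu => hp u (p.support_bypass_subset_support hu)⟩

end HyperbolicFilling

/-! ### Functions of weak type -/

/-- The distribution function of `g` is bounded by `K t⁻ᵖ`. -/
def HasWeakBound {ι : Type*} (q : ℝ) (K : ℝ≥0) (g : ι → ℝ≥0∞) : Prop :=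
  ∀ t : ℝ≥0, 0 < t →
    ((Set.encard {x | (t : ℝ≥0∞) < g x} : ℕ∞) : ℝ≥0∞) ≤ (K / t ^ q : ℝ≥0)

theorem exists_hasWeakBound_of_weakNorm_ne_top {ι : Type*} {q : ℝ} {f : ι → ℝ≥0∞}
    (h : weakNorm q f ≠ ∞) : ∃ K : ℝ≥0, HasWeakBound q K f := by
  obtain ⟨C, hC⟩ := iInf_lt_iff.1 h.lt_top
  obtain ⟨⟨hC0, hCb⟩, -⟩ := iInf_lt_iff.1 hC
  refine ⟨C ^ q, fun t ht => (hCb t ht).trans_eq ?_⟩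
  rw [ENNReal.coe_div (NNReal.rpow_pos ht).ne', ENNReal.coe_rpow_of_ne_zero hC0.ne',
    ENNReal.coe_rpow_of_ne_zero ht.ne']

/-- At the level `t = (K + 1) ^ q⁻¹` the counting bound is `K / (K + 1) < 1`, so no value exceeds
`t`. -/
theorem HasWeakBound.le {ι : Type*} {q : ℝ} (hq : 0 < q) {K : ℝ≥0} {g : ι → ℝ≥0∞}
    (hg : HasWeakBound q K g) (i : ι) : g i ≤ ((K + 1) ^ q⁻¹ : ℝ≥0) := by
  by_contra! hlt
  have ht : 0 < (K + 1) ^ q⁻¹ := NNReal.rpow_pos (by positivity)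
  have h := hg _ ht
  rw [← NNReal.rpow_mul, inv_mul_cancel₀ hq.ne', NNReal.rpow_one] at h
  have h1 : (1 : ℝ≥0∞) ≤ ((Set.encard {x | (((K + 1) ^ q⁻¹ : ℝ≥0) : ℝ≥0∞) < g x} : ℕ∞) : ℝ≥0∞) := by
    have : (1 : ℕ∞) ≤ Set.encard {x | (((K + 1) ^ q⁻¹ : ℝ≥0) : ℝ≥0∞) < g x} :=
      one_le_encard_iff_nonempty.2 ⟨i, hlt⟩
    simpa using ENat.toENNReal_le.2 this
  have h2 : K / (K + 1) < 1 := (div_lt_one (by positivity)).2 (lt_add_one K)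
  exact (h1.trans h).not_gt (by exact_mod_cast h2)

/-- Functions in weak `ℓ^q` belong to `ℓ^Q` for all `Q > q`. -/
theorem HasWeakBound.tsum_rpow_ne_top {ι : Type*} {q Q : ℝ} (hq : 0 < q) (hqQ : q < Q) {K : ℝ≥0}
    {g : ι → ℝ≥0∞} (hg : HasWeakBound q K g) : ∑' i, g i ^ Q ≠ ∞ := by
  obtain ⟨T, hT0, hgT⟩ : ∃ T : ℝ≥0, 0 < T ∧ ∀ i, g i ≤ T :=
    ⟨_, NNReal.rpow_pos (by positivity), hg.le hq⟩
  have hQ : 0 < Q := hq.trans hqQ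
  -- Dyadic layers below the maximum: layer `j` has `O(2 ^ (j * q))` elements, each contributing
  -- `O(2 ^ (-j * Q))`.
  set a : ℕ → ℝ≥0 := fun j => T * (1 / 2) ^ j with ha
  have ha0 : ∀ j, 0 < a j := fun j => by positivity
  set S : ℕ → Set ι := fun j => {i | (a (j + 1) : ℝ≥0∞) < g i} with hS
  have hle : ∀ i, g i ^ Q ≤ ∑' j, (S j).indicator (fun _ => ((a j ^ Q : ℝ≥0) : ℝ≥0∞)) i := by
    intro i
    rcases eq_or_ne (g i) 0 with h0 | h0
    · rw [h0, ENNReal.zero_rpow_of_pos hQ]; exact zero_le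
    have hiT := hgT i
    lift g i to ℝ≥0 using ne_top_of_le_ne_top ENNReal.coe_ne_top hiT with x hx
    have hx0 : 0 < x := pos_iff_ne_zero.2 (by simpa using h0)
    have hxT : x ≤ T := by exact_mod_cast hiT
    obtain ⟨j, hj, hj'⟩ := exists_nat_pow_near_of_lt_one (x := x / T) (y := (1 / 2 : ℝ≥0))
      (by positivity) ((div_le_one hT0).2 hxT) (by positivity) (by
        rw [← NNReal.coe_lt_coe]; norm_num)
    rw [lt_div_iff₀ hT0, mul_comm] at hj
    rw [div_le_iff₀ hT0, mul_comm] at hj'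
    refine le_trans ?_ (ENNReal.le_tsum j)
    rw [indicator_of_mem (show i ∈ S j by simp only [hS, mem_ofPred_eq, ← hx]; exact_mod_cast hj),
      ← ENNReal.coe_rpow_of_nonneg _ hQ.le]
    exact_mod_cast NNReal.rpow_le_rpow hj' hQ.le
  refine ne_top_of_le_ne_top ?_ (ENNReal.tsum_le_tsum hle)
  rw [ENNReal.tsum_comm]
  have hterm : ∀ j, ∑' i, (S j).indicator (fun _ => ((a j ^ Q : ℝ≥0) : ℝ≥0∞)) i ≤
      ((K * 2 ^ q * T ^ (Q - q) * ((1 / 2) ^ (Q - q)) ^ j : ℝ≥0) : ℝ≥0∞) := by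
    intro j
    rw [← tsum_subtype, ENNReal.tsum_set_const]
    refine (mul_le_mul_left (hg _ (ha0 (j + 1))) _).trans_eq ?_
    rw [← ENNReal.coe_mul]
    congr 1
    have h2 : a j = 2 * a (j + 1) := by
      simp only [ha, pow_succ]
      rw [← NNReal.coe_inj]
      push_cast
      ring
    have h3 : a j ^ Q = a j ^ q * a j ^ (Q - q) := by
      rw [← NNReal.rpow_add (ha0 j).ne']; ring_nf
    have h4 : a j ^ (Q - q) = T ^ (Q - q) * ((1 / 2) ^ (Q - q)) ^ j := by
      simp only [ha]
      rw [NNReal.mul_rpow, ← NNReal.rpow_natCast (1 / 2) j,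
        ← NNReal.rpow_natCast ((1 / 2) ^ (Q - q)) j, ← NNReal.rpow_mul, ← NNReal.rpow_mul,
        mul_comm (j : ℝ)]
    have h5 : a j ^ q = 2 ^ q * a (j + 1) ^ q := by rw [h2, NNReal.mul_rpow]
    have h6 : a (j + 1) ^ q ≠ 0 := (NNReal.rpow_pos (ha0 _)).ne'
    rw [h3, h4, h5]
    field_simp
  refine ne_top_of_le_ne_top ?_ (ENNReal.tsum_le_tsum hterm)
  rw [ENNReal.tsum_coe_ne_top_iff_summable]
  refine (NNReal.summable_geometric ?_).mul_left _
  exact NNReal.rpow_lt_one (by rw [← NNReal.coe_lt_coe]; norm_num) (sub_pos.2 hqQ)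

/-! ### Vertex weights and the bad set of endpoints -/

namespace HyperbolicFilling

variable {Z : Type*} [MetricSpace Z] {X : HyperbolicFilling Z}

/-- The supremum of the values of `τ` on the edges at a vertex. -/
noncomputable def vertexSup (τ : X.graph.edgeSet → ℝ≥0∞) (v : X.Vertex) : ℝ≥0∞ :=
  ⨆ (e : X.graph.edgeSet) (_ : v ∈ e.1), τ e

theorem le_vertexSup {τ : X.graph.edgeSet → ℝ≥0∞} {e : X.graph.edgeSet} {v : X.Vertex}
    (h : v ∈ e.1) : τ e ≤ vertexSup τ v :=
  le_iSup₂ (f := fun (e : X.graph.edgeSet) (_ : v ∈ e.1) => τ e) e h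

/-- The factor `2` counts the endpoints of an edge; no bound on the vertex degrees is needed. -/
theorem HasWeakBound.vertexSup {τ : X.graph.edgeSet → ℝ≥0∞} {q : ℝ} {K : ℝ≥0}
    (h : HasWeakBound q K τ) : HasWeakBound q (2 * K) (vertexSup τ) := by
  classical
  intro t ht
  have hfin : {e | (t : ℝ≥0∞) < τ e}.Finite := by
    rw [← encard_lt_top_iff, ← ENat.toENNReal_lt, ENat.toENNReal_top]
    exact (h t ht).trans_lt ENNReal.coe_lt_top
  set F : Finset (X.graph.edgeSet) := hfin.toFinset with hF
  have hsub : {v | (t : ℝ≥0∞) < HyperbolicFilling.vertexSup τ v} ⊆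
      ((F.biUnion fun e => e.1.toFinset : Finset X.Vertex) : Set X.Vertex) := by
    intro v hv
    obtain ⟨e, he⟩ := lt_iSup_iff.1 (show (t : ℝ≥0∞) < HyperbolicFilling.vertexSup τ v from hv)
    obtain ⟨hve, he⟩ := lt_iSup_iff.1 he
    rw [Finset.mem_coe, Finset.mem_biUnion]
    exact ⟨e, hfin.mem_toFinset.2 he, Sym2.mem_toFinset.2 hve⟩
  have hcard : (F.biUnion fun e => e.1.toFinset).card ≤ F.card * 2 :=
    Finset.card_biUnion_le_card_mul _ _ _ fun e _ => by
      rcases e with ⟨e, he⟩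
      rw [Sym2.card_toFinset_of_not_isDiag _ (X.graph.not_isDiag_of_mem_edgeSet he)]
  have hFc : (F.card : ℝ≥0∞) ≤ (K / t ^ q : ℝ≥0) := by
    have h1 := h t ht
    rwa [hfin.encard_eq_coe_toFinset_card, ENat.toENNReal_coe] at h1
  calc ((Set.encard {v | (t : ℝ≥0∞) < HyperbolicFilling.vertexSup τ v} : ℕ∞) : ℝ≥0∞)
      ≤ (((F.biUnion fun e => e.1.toFinset).card : ℕ∞) : ℝ≥0∞) := by
        refine ENat.toENNReal_le.2 ((encard_le_encard hsub).trans_eq ?_)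
        rw [encard_coe_eq_coe_finsetCard]
    _ ≤ ((F.card * 2 : ℕ) : ℝ≥0∞) := by
        rw [ENat.toENNReal_coe]; exact_mod_cast hcard
    _ = 2 * F.card := by push_cast; ring
    _ ≤ 2 * (K / t ^ q : ℝ≥0) := by gcongr
    _ = _ := by
      rw [mul_div_assoc]; push_cast; rfl

/-- The points contained in balls of vertices of arbitrarily high level `k` at which `m` exceeds
`b ^ k`. -/
def badSet (b : ℝ≥0) (m : X.Vertex → ℝ≥0∞) : Set Z :=
  {z | ∃ᶠ k in atTop, ∃ v : X.Vertex, v.level = k ∧ z ∈ v.ball ∧ ((b ^ k : ℝ≥0) : ℝ≥0∞) < m v}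

/-- Off the bad set the weights along a descent are eventually dominated by `b ^ k`, so their tails
vanish. -/
theorem eventually_tsum_le_of_notMem_badSet {b : ℝ≥0} (hb : b < 1) {m : X.Vertex → ℝ≥0∞} {z : Z}
    (hz : z ∉ badSet b m) {v : ℕ → X.Vertex} (hv : ∀ k, (v k).level = k)
    (hvz : ∀ k, z ∈ (v k).ball) {ε : ℝ≥0∞} (hε : 0 < ε) :
    ∀ᶠ n in atTop, ∑' k, m (v (k + n)) ≤ ε := by
  have hev : ∀ᶠ k in atTop, m (v k) ≤ ((b ^ k : ℝ≥0) : ℝ≥0∞) := by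
    have h := not_frequently.1 (show ¬ ∃ᶠ k in atTop, _ from hz)
    filter_upwards [h] with k hk
    by_contra! hlt
    exact hk ⟨v k, hv k, hvz k, hlt⟩
  have hsum : ∑' k, ((b ^ k : ℝ≥0) : ℝ≥0∞) ≠ ∞ :=
    ENNReal.tsum_coe_ne_top_iff_summable.2 (NNReal.summable_geometric hb)
  have htail := (ENNReal.tendsto_sum_nat_add _ hsum).eventually_le_const hε
  filter_upwards [htail, eventually_forall_ge_atTop.2 hev] with n h1 h2
  exact (ENNReal.tsum_le_tsum fun k => h2 (k + n) (by omega)).trans h1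

/-- For weights of weak type `ℓ^q` the distances of the points of the bad set from a point form
a null set. -/
theorem volume_dist_image_badSet [Countable X.Vertex] {q : ℝ} (hq : 0 < q) {K : ℝ≥0}
    {m : X.Vertex → ℝ≥0∞} (hm : HasWeakBound q K m) (p : Z) :
    ∃ b : ℝ≥0, b < 1 ∧ volume ((fun z => dist p z) '' badSet b m) = 0 := by
  have hs := X.s_pos
  have hs' : 0 < X.s⁻¹ := inv_pos.2 hs
  have hs1 : X.s⁻¹ < 1 := inv_lt_one_of_one_lt₀ X.one_lt_s
  set σ : ℝ≥0 := X.s⁻¹.toNNReal with hσ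
  have hσ0 : 0 < σ := Real.toNNReal_pos.2 hs'
  have hσ1 : σ < 1 := by rw [hσ, Real.toNNReal_lt_one]; exact hs1
  have hσs : (σ : ℝ) = X.s⁻¹ := Real.coe_toNNReal _ hs'.le
  -- Chosen so that `(b ^ k) ^ q = σ ^ (k / 2)`: at most `K * σ ^ (-k / 2)` exceptional balls of
  -- radius of order `σ ^ k` have summable total length.
  set b : ℝ≥0 := σ ^ (2 * q)⁻¹ with hb
  have hb0 : 0 < b := NNReal.rpow_pos hσ0
  refine ⟨b, NNReal.rpow_lt_one hσ1 (by positivity), ?_⟩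
  set B : ℕ → Set X.Vertex := fun k => {v | v.level = k ∧ ((b ^ k : ℝ≥0) : ℝ≥0∞) < m v} with hB
  set E : ℕ → Set ℝ := fun k => ⋃ v ∈ B k, Metric.ball (dist p v.center) v.radius with hE
  -- Borel–Cantelli on the line: the distance from `p` is `1`-Lipschitz, so it maps each exceptional
  -- ball into an interval of the same radius.
  have hsub : (fun z => dist p z) '' badSet b m ⊆ limsup E atTop := by
    rintro _ ⟨z, hz, rfl⟩
    rw [mem_limsup_iff_frequently_mem]
    refine Frequently.mono hz ?_
    rintro k ⟨v, hv, hzv, hmv⟩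
    refine mem_biUnion (show v ∈ B k from ⟨hv, hmv⟩) ?_
    simp only [Metric.mem_ball, Real.dist_eq, dist_comm p]
    exact (abs_dist_sub_le z v.center p).trans_lt hzv
  have hbound : ∀ k, volume (E k) ≤
      ((K * (4 * X.R).toNNReal * (σ ^ (1 / 2 : ℝ)) ^ k : ℝ≥0) : ℝ≥0∞) := by
    intro k
    have hcard : ((B k).encard : ℝ≥0∞) ≤ (K / (b ^ k) ^ q : ℝ≥0) :=
      (ENat.toENNReal_le.2 (encard_le_encard fun v hv => hv.2)).trans (hm (b ^ k) (by positivity))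
    calc volume (E k) ≤ ∑' v : B k, volume (Metric.ball (dist p (v : X.Vertex).center)
          (v : X.Vertex).radius) := measure_biUnion_le _ (to_countable _) _
      _ = ∑' v : B k, (((4 * X.R).toNNReal * σ ^ k : ℝ≥0) : ℝ≥0∞) := by
        refine tsum_congr fun v => ?_
        rw [Real.volume_ball, Vertex.radius_eq, v.2.1, mesh]
        rw [← ENNReal.ofReal_coe_nnreal]
        congr 1
        push_cast
        rw [Real.coe_toNNReal _ (by linarith [X.R_pos]), hσs]
        ring
      _ = (B k).encard * (((4 * X.R).toNNReal * σ ^ k : ℝ≥0) : ℝ≥0∞) := ENNReal.tsum_set_const _ _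
      _ ≤ (K / (b ^ k) ^ q : ℝ≥0) * (((4 * X.R).toNNReal * σ ^ k : ℝ≥0) : ℝ≥0∞) := by gcongr
      _ = _ := by
        rw [← ENNReal.coe_mul]
        congr 1
        have h1 : (b ^ k) ^ q = (σ ^ (1 / 2 : ℝ)) ^ k := by
          rw [hb, ← NNReal.rpow_natCast, ← NNReal.rpow_natCast, ← NNReal.rpow_mul,
            ← NNReal.rpow_mul, ← NNReal.rpow_mul]
          congr 1
          field_simp
        have h2 : σ ^ k = (σ ^ (1 / 2 : ℝ)) ^ k * (σ ^ (1 / 2 : ℝ)) ^ k := by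
          rw [← mul_pow, ← NNReal.rpow_add hσ0.ne']
          norm_num
        have h3 : (σ ^ (1 / 2 : ℝ)) ^ k ≠ 0 := pow_ne_zero _ (NNReal.rpow_pos hσ0).ne'
        rw [h1, h2]
        field_simp
  refine measure_mono_null hsub (measure_limsup_atTop_eq_zero ?_)
  refine ne_top_of_le_ne_top ?_ (ENNReal.tsum_le_tsum hbound)
  rw [ENNReal.tsum_coe_ne_top_iff_summable]
  exact (NNReal.summable_geometric (NNReal.rpow_lt_one hσ1 (by norm_num))).mul_left _

end HyperbolicFilling

/-! ### Path families of modulus zero -/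

section Modulus

variable {Z : Type*} [MetricSpace Z] [MeasurableSpace Z] {μ : Measure Z} {p Q : ℝ}

theorem pathModulus_eq_zero_iff {Γ : Set (MetricPath Z)} :
    pathModulus μ p Γ = 0 ↔
      ∀ ε : ℝ≥0∞, 0 < ε → ∃ ρ, IsModulusAdmissible Γ ρ ∧ ∫⁻ z, ρ z ^ p ∂μ ≤ ε := by
  constructor
  · intro h ε hε
    obtain ⟨ρ, hρ⟩ := iInf_lt_iff.1 (h.trans_lt hε : pathModulus μ p Γ < ε)
    obtain ⟨hadm, hρ⟩ := iInf_lt_iff.1 hρ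
    exact ⟨ρ, hadm, hρ.le⟩
  · intro h
    refine le_antisymm (le_of_forall_gt_imp_ge_of_dense fun ε hε => ?_) zero_le
    obtain ⟨ρ, hadm, hρ⟩ := h ε hε
    exact (iInf₂_le ρ hadm).trans hρ

theorem IsModulusAdmissible.mono {Γ Γ' : Set (MetricPath Z)} {ρ : Z → ℝ≥0∞}
    (h : IsModulusAdmissible Γ' ρ) (hΓ : Γ ⊆ Γ') : IsModulusAdmissible Γ ρ :=
  ⟨h.1, fun γ hγ => h.2 γ (hΓ hγ)⟩

theorem pathModulus_mono {Γ Γ' : Set (MetricPath Z)} (hΓ : Γ ⊆ Γ') :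
    pathModulus μ p Γ ≤ pathModulus μ p Γ' :=
  le_iInf₂ fun ρ hρ => iInf₂_le ρ (hρ.mono hΓ)

theorem iSup_rpow_le_tsum {ι : Type*} (hp : 0 < p) (f : ι → ℝ≥0∞) :
    (⨆ i, f i) ^ p ≤ ∑' i, f i ^ p := by
  rw [← ENNReal.le_rpow_inv_iff hp]
  refine iSup_le fun i => ?_
  rw [ENNReal.le_rpow_inv_iff hp]
  exact ENNReal.le_tsum i

theorem lintegral_iSup_rpow_le {α ι : Type*} [MeasurableSpace α] {μ : Measure α}
    [Countable ι] (hp : 0 < p) {f : ι → α → ℝ≥0∞}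
    (hf : ∀ i, Measurable (f i)) :
    ∫⁻ z, (⨆ i, f i z) ^ p ∂μ ≤ ∑' i, ∫⁻ z, f i z ^ p ∂μ := by
  rw [← lintegral_tsum fun i => ((hf i).pow_const p).aemeasurable]
  exact lintegral_mono fun z => iSup_rpow_le_tsum hp _

/-- The supremum of the individual densities is admissible for the union, and its energy is at most
the sum of theirs. -/
theorem pathModulus_iUnion_eq_zero {ι : Type*} [Countable ι] (hp : 0 < p)
    {Γ : ι → Set (MetricPath Z)} (h : ∀ i, pathModulus μ p (Γ i) = 0) :
    pathModulus μ p (⋃ i, Γ i) = 0 := by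
  refine pathModulus_eq_zero_iff.2 fun ε hε => ?_
  obtain ⟨ε', hε', hsum⟩ := ENNReal.exists_pos_sum_of_countable hε.ne' ι
  choose ρ hadm hρ using fun i =>
    pathModulus_eq_zero_iff.1 (h i) (ε' i) (ENNReal.coe_pos.2 (hε' i))
  refine ⟨fun z => ⨆ i, ρ i z, ⟨Measurable.iSup fun i => (hadm i).1, fun γ hγ hrect => ?_⟩, ?_⟩
  · obtain ⟨i, hi⟩ := mem_iUnion.1 hγ
    exact ((hadm i).2 γ hi hrect).trans
      (γ.lineIntegral_mono fun z => le_iSup (fun i => ρ i z) i)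
  · exact ((lintegral_iSup_rpow_le hp fun i => (hadm i).1).trans
      (ENNReal.tsum_le_tsum hρ)).trans hsum.le

/-- Substitute for Hölder's inequality: `x ^ p` is at most `d ^ p` for `x ≤ d`, and beyond `d` the
factor `x ^ (p - Q)` is at most `d ^ (p - Q)`. -/
theorem ENNReal.rpow_le_add_rpow {x d : ℝ≥0∞} (hd : d ≠ ∞) (hp : 0 ≤ p) (hpQ : p ≤ Q)
    (hQ : 0 < Q) : x ^ p ≤ d ^ p + d ^ (p - Q) * x ^ Q := by
  rcases le_or_gt x d with h | h
  · exact (ENNReal.rpow_le_rpow h hp).trans le_self_add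
  · refine le_trans ?_ le_add_self
    rcases eq_or_ne x ∞ with rfl | hx
    · have hd0 : d ^ (p - Q) ≠ 0 := by
        rw [Ne, ENNReal.rpow_eq_zero_iff]
        push Not
        exact ⟨fun _ => by linarith, fun h => absurd h hd⟩
      rw [ENNReal.top_rpow_of_pos hQ, ENNReal.mul_top hd0]
      exact le_top
    · have hx0 : x ≠ 0 := (zero_le.trans_lt h).ne'
      calc x ^ p = x ^ (p - Q) * x ^ Q := by rw [← ENNReal.rpow_add _ _ hx0 hx, sub_add_cancel]
        _ ≤ _ := by
          refine mul_le_mul_left ?_ _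
          rw [← neg_sub, ENNReal.rpow_neg, ENNReal.rpow_neg, ENNReal.inv_le_inv]
          exact ENNReal.rpow_le_rpow h.le (by linarith)

/-- On a finite measure space the families of modulus zero increase with decreasing exponent. -/
theorem pathModulus_eq_zero_of_le [IsFiniteMeasure μ] (hp : 0 < p) (hpQ : p ≤ Q)
    {Γ : Set (MetricPath Z)} (h : pathModulus μ Q Γ = 0) : pathModulus μ p Γ = 0 := by
  refine pathModulus_eq_zero_iff.2 fun ε hε => ?_
  have hlim : Tendsto (fun d : ℝ≥0∞ => d ^ p * μ univ) (𝓝 0) (𝓝 0) := by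
    have := ENNReal.Tendsto.mul_const (b := μ univ)
      ((ENNReal.continuous_rpow_const (y := p)).tendsto 0) (Or.inr (measure_ne_top μ univ))
    simpa [hp] using this
  -- The threshold `d` is fixed first; only then is `ρ` chosen with `Q`-energy small relative to `d
  -- ^ (p - Q)`.
  obtain ⟨d, hd, hd0, hd1⟩ : ∃ d : ℝ≥0∞, d ^ p * μ univ < ε / 2 ∧ 0 < d ∧ d < 1 := by
    have h1 := hlim.eventually_lt_const (ENNReal.half_pos hε.ne')
    obtain ⟨e, he, hball⟩ := ENNReal.nhds_zero_basis.eventually_iff.1 h1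
    obtain ⟨d, hd, hd'⟩ := exists_between (lt_min he one_pos)
    exact ⟨d, hball (hd'.trans_le (min_le_left _ _)), hd, hd'.trans_le (min_le_right _ _)⟩
  have hdt : d ≠ ∞ := (hd1.trans ENNReal.one_lt_top).ne
  have hc : d ^ (p - Q) ≠ ∞ := by
    rw [Ne, ENNReal.rpow_eq_top_iff]
    push Not
    exact ⟨fun h => absurd h hd0.ne', fun h => absurd h hdt⟩
  obtain ⟨ρ, hadm, hρ⟩ := pathModulus_eq_zero_iff.1 h (ε / 2 / d ^ (p - Q))
    (ENNReal.div_pos (ENNReal.half_pos hε.ne').ne' hc)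
  refine ⟨ρ, hadm, ?_⟩
  calc ∫⁻ z, ρ z ^ p ∂μ ≤ ∫⁻ z, (d ^ p + d ^ (p - Q) * ρ z ^ Q) ∂μ :=
        lintegral_mono fun z => ENNReal.rpow_le_add_rpow hdt hp.le hpQ (hp.trans_le hpQ)
    _ = d ^ p * μ univ + d ^ (p - Q) * ∫⁻ z, ρ z ^ Q ∂μ := by
      rw [lintegral_add_left measurable_const, lintegral_const,
        lintegral_const_mul _ (hadm.1.pow_const Q)]
    _ ≤ ε / 2 + ε / 2 := add_le_add hd.le ((mul_le_mul_right hρ _).trans ENNReal.mul_div_le)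
    _ = ε := ENNReal.add_halves ε

/-- If a summable sequence of densities has line integrals at least `1 / 2` infinitely often along
every rectifiable path of a family, then the family has modulus zero. -/
theorem pathModulus_eq_zero_of_frequently (hp : 0 < p) {Γ : Set (MetricPath Z)}
    {ρ : ℕ → Z → ℝ≥0∞} (hρ : ∀ n, Measurable (ρ n)) (hsum : ∑' n, ∫⁻ z, ρ n z ^ p ∂μ ≠ ∞)
    (h : ∀ γ ∈ Γ, γ.Rectifiable → ∃ᶠ n in atTop, 1 / 2 ≤ γ.lineIntegral (ρ n)) :
    pathModulus μ p Γ = 0 := by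
  have hρ' : ∀ n, Measurable fun z => 2 * ρ n z := fun n => (hρ n).const_mul 2
  have hmul : ∀ n, ∫⁻ z, (2 * ρ n z) ^ p ∂μ = 2 ^ p * ∫⁻ z, ρ n z ^ p ∂μ := fun n => by
    simp only [ENNReal.mul_rpow_of_nonneg _ _ hp.le]
    exact lintegral_const_mul _ ((hρ n).pow_const p)
  have hsum' : ∑' n, ∫⁻ z, (2 * ρ n z) ^ p ∂μ ≠ ∞ := by
    simp only [hmul]
    rw [ENNReal.tsum_mul_left]
    exact ENNReal.mul_ne_top (ENNReal.rpow_ne_top_of_nonneg hp.le ENNReal.ofNat_ne_top) hsum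
  refine pathModulus_eq_zero_iff.2 fun ε hε => ?_
  obtain ⟨N, hN⟩ := ((ENNReal.tendsto_sum_nat_add _ hsum').eventually_lt_const hε).exists
  refine ⟨fun z => ⨆ k, 2 * ρ (k + N) z, ⟨Measurable.iSup fun k => hρ' _, fun γ hγ hrect => ?_⟩,
    (lintegral_iSup_rpow_le hp fun k => hρ' (k + N)).trans hN.le⟩
  obtain ⟨n, hn, hnN⟩ := ((h γ hγ hrect).and_eventually (eventually_ge_atTop N)).exists
  obtain ⟨k, rfl⟩ := Nat.exists_eq_add_of_le' hnN
  calc (1 : ℝ≥0∞) = 2 * (1 / 2) := by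
        rw [one_div, ENNReal.mul_inv_cancel two_ne_zero ENNReal.ofNat_ne_top]
    _ ≤ 2 * γ.lineIntegral (ρ (k + N)) := by gcongr
    _ = γ.lineIntegral fun z => 2 * ρ (k + N) z :=
      (lintegral_const_mul' _ _ ENNReal.ofNat_ne_top).symm
    _ ≤ _ := γ.lineIntegral_mono fun z => le_iSup (fun k => 2 * ρ (k + N) z) k

end Modulus

/-! ### Bi-infinite paths in a hyperbolic filling -/

namespace HyperbolicFilling

variable {Z : Type*} [MetricSpace Z] {X : HyperbolicFilling Z}

/-- The vertices of `v` have levels `0, 1, 2, …`, and `z` lies within one mesh of their centers. -/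
structure IsDescending (v : ℕ → X.Vertex) (z : Z) : Prop where
  level_eq : ∀ k, (v k).level = k
  dist_lt : ∀ k, dist z (v k).center < X.mesh k

variable (X) in
theorem exists_isDescending (z : Z) : ∃ v : ℕ → X.Vertex, IsDescending v z := by
  choose v hv hz using fun k => X.exists_vertex_mem_ball k z
  exact ⟨v, hv, hz⟩

namespace IsDescending

variable {v : ℕ → X.Vertex} {z : Z} (h : IsDescending v z)
include h

theorem mem_ball (k : ℕ) : z ∈ (v k).ball := by
  rw [Vertex.ball, Metric.mem_ball, Vertex.radius_eq, h.level_eq]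
  linarith [h.dist_lt k, X.mesh_pos k]

theorem adj (k : ℕ) : X.graph.Adj (v k) (v (k + 1)) := by
  refine adj_of_mem_ball (fun he => ?_) ?_ ?_ (h.mem_ball k) (h.mem_ball (k + 1))
  · have := congrArg Vertex.level he
    rw [h.level_eq, h.level_eq] at this
    omega
  · rw [h.level_eq, h.level_eq]; omega
  · rw [h.level_eq, h.level_eq]

/-- A sequence of vertices which agrees from some point on with a descending sequence and has
levels at most `n` before converges nontangentially. -/
theorem tendstoNontangentially {u : ℕ → X.Vertex} {L n : ℕ}
    (hlt : ∀ j < L, (u j).level = n) (hge : ∀ j, u (j + L) = v (j + n)) :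
    TendstoNontangentially u z := by
  have hmesh : Tendsto (fun j => X.mesh (j + n)) atTop (𝓝 0) :=
    X.tendsto_mesh.comp (tendsto_add_atTop_nat n)
  -- The finitely many initial vertices have radius `2 * X.mesh n`, and all distances are below `R`;
  -- later ones satisfy the condition with constant `1`.
  refine ⟨?_, ?_, max 1 (X.R / (2 * X.mesh n)), by positivity, fun j => ?_⟩
  · refine (tendsto_add_atTop_iff_nat L).1 ?_
    simp only [hge]
    refine tendsto_iff_dist_tendsto_zero.2 (squeeze_zero (fun _ => dist_nonneg) (fun j => ?_) hmesh)
    rw [dist_comm]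
    exact (h.dist_lt _).le
  · refine (tendsto_add_atTop_iff_nat L).1 ?_
    simp only [hge, Vertex.radius_eq, h.level_eq]
    simpa using hmesh.const_mul 2
  · rcases lt_or_ge j L with hj | hj
    · have hm := X.mesh_pos n
      calc dist z (u j).center ≤ X.R := (X.dist_lt_R _ _).le
        _ = X.R / (2 * X.mesh n) * (u j).radius := by
          rw [Vertex.radius_eq, hlt j hj]; field_simp
        _ ≤ _ := by
          gcongr
          · exact (u j).radius_pos.le
          · exact le_max_right _ _
    · obtain ⟨i, rfl⟩ := Nat.exists_eq_add_of_le' hj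
      calc dist z (u (i + L)).center ≤ 1 * (u (i + L)).radius := by
            rw [hge, Vertex.radius_eq, h.level_eq]
            linarith [h.dist_lt (i + n), X.mesh_pos (i + n)]
        _ ≤ _ := by
          gcongr
          · exact (u _).radius_pos.le
          · exact le_max_left _ _

end IsDescending

/-- The two-sided sequence with right half `u` and left half `w 1, w 2, …`. -/
def glue (u w : ℕ → X.Vertex) : ℤ → X.Vertex
  | Int.ofNat j => u j
  | Int.negSucc j => w (j + 1)

/-- An admissible function has length at least `1` along the path which descends to `a` and to `b`
from the end points of a walk of constant level. -/
theorem IsAdmissible.one_le {A B : Set Z} {τ : X.graph.edgeSet → ℝ≥0∞} (hτ : X.IsAdmissible A B τ)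
    {a b : Z} (ha : a ∈ A) (hb : b ∈ B) {va vb : ℕ → X.Vertex} (hva : IsDescending va a)
    (hvb : IsDescending vb b) {n : ℕ} (p : X.graph.Walk (va n) (vb n))
    (hp : ∀ u ∈ p.support, u.level = n) :
    1 ≤ ∑' k, vertexSup τ (va (k + n)) +
      (∑ j ∈ Finset.range p.length, vertexSup τ (p.getVert j) +
        ∑' k, vertexSup τ (vb (k + n))) := by
  set L := p.length with hL
  set u : ℕ → X.Vertex := fun j => if j < L then p.getVert j else vb (j - L + n) with hu
  have hult : ∀ j < L, u j = p.getVert j := fun j hj => if_pos hj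
  have huge : ∀ j, u (j + L) = vb (j + n) := fun j => by
    simp only [hu]; rw [if_neg (by omega), Nat.add_sub_cancel]
  have hule : ∀ j ≤ L, u j = p.getVert j := fun j hj => by
    rcases hj.lt_or_eq with h | rfl
    · exact hult j h
    · have := huge 0
      rw [zero_add, zero_add] at this
      rw [this, hL, p.getVert_length]
  have hu0 : u 0 = va n := by rw [hule 0 (Nat.zero_le _), p.getVert_zero]
  have huadj : ∀ j, X.graph.Adj (u j) (u (j + 1)) := fun j => by
    rcases lt_or_ge j L with hj | hj
    · rw [hult j hj, hule (j + 1) hj]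
      exact p.adj_getVert_succ hj
    · obtain ⟨i, rfl⟩ := Nat.exists_eq_add_of_le' hj
      rw [huge, show i + L + 1 = (i + 1) + L by ring, huge, show i + 1 + n = i + n + 1 by ring]
      exact hvb.adj _
  -- The two halves share the vertex `u 0 = va n`; index `0` of the left half is never evaluated by
  -- `glue`.
  set v : ℤ → X.Vertex := glue u fun j => va (j + n) with hv
  have hvpos : ∀ j : ℕ, v (j : ℤ) = u j := fun j => rfl
  have hvneg : ∀ j : ℕ, v (-(j : ℤ)) = va (j + n) := fun j => by
    cases j with
    | zero => simpa [hv, glue] using hu0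
    | succ j => rfl
  have hvadj : ∀ k : ℤ, X.graph.Adj (v k) (v (k + 1)) := by
    intro k
    rcases k with j | j
    · exact huadj j
    · have h1 : (Int.negSucc j : ℤ) = -((j + 1 : ℕ) : ℤ) := rfl
      have h2 : (Int.negSucc j : ℤ) + 1 = -(j : ℤ) := by rw [h1]; push_cast; ring
      rw [h2, hvneg, h1, hvneg, show j + 1 + n = j + n + 1 by ring]
      exact (hva.adj _).symm
  clear_value v
  have hmem : ∀ k : ℤ, s(v k, v (k + 1)) ∈ X.graph.edgeSet := fun k =>
    (SimpleGraph.mem_edgeSet _).2 (hvadj k)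
  have hmain : 1 ≤ ∑' k : ℤ, τ ⟨s(v k, v (k + 1)), hmem k⟩ := hτ v hvadj a ha b hb
    (by
      simp only [hvneg]
      exact hva.tendstoNontangentially (L := 0) (n := n) (by simp) fun j => rfl)
    (by
      simp only [hvpos]
      refine hvb.tendstoNontangentially (L := L) (n := n) (fun j hj => ?_) huge
      rw [hult j hj]
      exact hp _ (p.getVert_mem_support j))
  rw [tsum_of_nat_of_neg_add_one ENNReal.summable ENNReal.summable] at hmain
  rw [add_comm (∑' k, vertexSup τ (va (k + n)))]
  refine hmain.trans (add_le_add ?_ ?_)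
  · have hle : ∀ j : ℕ, τ ⟨s(v (j : ℤ), v ((j : ℤ) + 1)), hmem j⟩ ≤ vertexSup τ (u j) := fun j =>
      le_vertexSup (hvpos j ▸ Sym2.mem_mk_left _ _)
    refine (ENNReal.tsum_le_tsum hle).trans_eq ?_
    rw [← (ENNReal.summable (f := fun j => vertexSup τ (u (j + L)))).sum_add_tsum_nat_add'
      (f := fun j => vertexSup τ (u j))]
    simp only [huge]
    congr 1
    exact Finset.sum_congr rfl fun j hj => by rw [hult j (Finset.mem_range.1 hj)]
  · refine ENNReal.tsum_le_tsum fun j => le_vertexSup ?_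
    have h1 : -((j : ℤ) + 1) + 1 = -(j : ℤ) := by ring
    have h2 : va (j + n) = v (-((j : ℤ) + 1) + 1) := by rw [h1, hvneg]
    rw [h2]
    exact Sym2.mem_mk_right _ _

/-- On a simple path no vertex is counted twice, so the sum along it is at most the sum over its
support. -/
theorem sum_getVert_le_sum [DecidableEq X.Vertex] {v w : X.Vertex} {p : X.graph.Walk v w}
    (hp : p.IsPath) (m : X.Vertex → ℝ≥0∞) :
    ∑ j ∈ Finset.range p.length, m (p.getVert j) ≤ ∑ u ∈ p.support.toFinset, m u := by
  have hinj : Set.InjOn p.getVert (Finset.range p.length : Set ℕ) :=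
    hp.getVert_injOn.mono fun j hj => (Finset.mem_range.1 hj).le
  rw [← Finset.sum_image (f := m) hinj]
  refine Finset.sum_le_sum_of_subset fun u hu => ?_
  obtain ⟨j, -, rfl⟩ := Finset.mem_image.1 hu
  exact List.mem_toFinset.2 (p.getVert_mem_support j)

end HyperbolicFilling

/-! ### Weak capacity and modulus -/

namespace HyperbolicFilling

variable {Z : Type*} [MetricSpace Z] (X : HyperbolicFilling Z)

/-- The function on `Z` which distributes the weights of the vertices of level `n` in `F` over the
concentric balls of twice the radius. -/
noncomputable def density (F : Finset X.Vertex) (m : X.Vertex → ℝ≥0∞) (n : ℕ) (z : Z) : ℝ≥0∞ :=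
  ∑ v ∈ F, (Metric.ball v.center (2 * (2 * X.mesh n))).indicator
    (fun _ => m v / ENNReal.ofReal (2 * X.mesh n)) z

theorem measurable_density [MeasurableSpace Z] [OpensMeasurableSpace Z] (F : Finset X.Vertex)
    (m : X.Vertex → ℝ≥0∞) (n : ℕ) : Measurable (X.density F m n) :=
  Finset.measurable_fun_sum _ fun _ _ =>
    measurable_const.indicator Metric.isOpen_ball.measurableSet

theorem tsum_sum_level_le {F : ℕ → Finset X.Vertex} (hF : ∀ n, ∀ v ∈ F n, v.level = n)
    (f : X.Vertex → ℝ≥0∞) : ∑' n, ∑ v ∈ F n, f v ≤ ∑' v, f v := by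
  have h : ∀ n, ∑ v ∈ F n, f v ≤ ∑' v : X.Vertex, if v.level = n then f v else 0 := fun n => by
    refine le_trans (Finset.sum_le_sum fun v hv => ?_) (ENNReal.sum_le_tsum (F n))
    rw [if_pos (hF n v hv)]
  refine (ENNReal.tsum_le_tsum h).trans ?_
  rw [ENNReal.tsum_comm]
  refine ENNReal.tsum_le_tsum fun v => ?_
  rw [tsum_ite_eq' v.level fun _ => f v]

/-- The horizontal part of a path in the filling which follows a rectifiable path is controlled by
the line integral of the density. -/
theorem eventually_half_le_lineIntegral [MeasurableSpace Z] [BorelSpace Z] {A B : Set Z}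
    {τ : X.graph.edgeSet → ℝ≥0∞}
    (hτ : X.IsAdmissible A B τ) {bA bB : ℝ≥0} (hbA : bA < 1) (hbB : bB < 1) {γ : MetricPath Z}
    (hγ : γ.Rectifiable) {s t : ℝ} (hs : s ∈ γ.dom) (ht : t ∈ γ.dom) (hsA : γ.toFun s ∈ A)
    (htB : γ.toFun t ∈ B) (hst : γ.toFun s ≠ γ.toFun t)
    (hsb : γ.toFun s ∉ badSet bA (vertexSup τ)) (htb : γ.toFun t ∉ badSet bB (vertexSup τ))
    {F : ℕ → Finset X.Vertex} (hF : ∀ n (v : X.Vertex), v.level = n → v ∈ F n) :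
    ∀ᶠ n in atTop, 1 / 2 ≤ γ.lineIntegral (X.density (F n) (vertexSup τ) n) := by
  classical
  obtain ⟨va, hva⟩ := X.exists_isDescending (γ.toFun s)
  obtain ⟨vb, hvb⟩ := X.exists_isDescending (γ.toFun t)
  -- Each vertical tail may cost `1 / 4`, leaving `1 / 2` for the horizontal part.
  have hquarter : (0 : ℝ≥0∞) < 1 / 2 / 2 := by simp
  -- The doubled balls have radius `4 * X.mesh n`; endpoints more than `8 * X.mesh n` apart cannot
  -- both lie in one, so the path leaves each of them.
  have hmesh : ∀ᶠ n in atTop, 8 * X.mesh n < dist (γ.toFun s) (γ.toFun t) := by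
    have h := X.tendsto_mesh.const_mul 8
    rw [mul_zero] at h
    exact h.eventually_lt_const (dist_pos.2 hst)
  filter_upwards [eventually_tsum_le_of_notMem_badSet hbA hsb hva.level_eq hva.mem_ball hquarter,
    eventually_tsum_le_of_notMem_badSet hbB htb hvb.level_eq hvb.mem_ball hquarter, hmesh]
    with n h1 h2 h3
  obtain ⟨p, hp, hpsupp⟩ := X.exists_isPath_of_isPreconnected γ.isPreconnected_image
    (hva.level_eq n) (hvb.level_eq n) ⟨_, mem_image_of_mem _ hs, hva.mem_ball n⟩
    ⟨_, mem_image_of_mem _ ht, hvb.mem_ball n⟩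
  have hone := hτ.one_le hsA htB hva hvb p fun u hu => (hpsupp u hu).1
  have hline : ∑ u ∈ p.support.toFinset, vertexSup τ u ≤
      γ.lineIntegral (X.density (F n) (vertexSup τ) n) := by
    refine hγ.sum_le_lineIntegral (F n) p.support.toFinset (fun u hu => ?_) (vertexSup τ)
      Vertex.center (mul_pos two_pos (X.mesh_pos n)) fun u hu => ?_
    · exact hF n u (hpsupp u (List.mem_toFinset.1 hu)).1
    · obtain ⟨hul, z, ⟨t', ht', rfl⟩, hz⟩ := hpsupp u (List.mem_toFinset.1 hu)
      rw [Vertex.ball, Metric.mem_ball, Vertex.radius_eq, hul, dist_comm] at hz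
      refine ⟨⟨t', ht', hz.le⟩, ?_⟩
      by_contra! hlt
      linarith [hlt s hs, hlt t ht, dist_triangle_left (γ.toFun s) (γ.toFun t) u.center]
  have hsum := (sum_getVert_le_sum hp (vertexSup τ)).trans hline
  by_contra! hlt
  have h4 : (1 : ℝ≥0∞) ≤ 1 / 2 / 2 + (γ.lineIntegral (X.density (F n) (vertexSup τ) n) +
      1 / 2 / 2) := hone.trans (add_le_add h1 (add_le_add hsum h2))
  rw [add_comm (γ.lineIntegral _), ← add_assoc, ENNReal.add_halves] at h4
  have h5 : (1 / 2 : ℝ≥0∞) + γ.lineIntegral (X.density (F n) (vertexSup τ) n) < 1 / 2 + 1 / 2 :=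
    ENNReal.add_lt_add_left (by simp) hlt
  rw [ENNReal.add_halves] at h5
  exact h4.not_gt h5

section Regular

variable [CompactSpace Z] [Nontrivial Z] [MeasurableSpace Z] [BorelSpace Z] {μ : Measure Z} {Q : ℝ}

/-- At most `M` doubled balls of a level overlap, so the `Q`-th power passes inside the sum at cost
`M ^ (Q - 1)`; the mass of a ball then cancels the factor `r ^ (-Q)`. -/
theorem exists_lintegral_density_rpow_le (hQ : 1 ≤ Q) (hμ : IsAhlforsRegular μ Q) :
    ∃ K : ℝ≥0∞, K ≠ ∞ ∧ ∀ (n : ℕ) (F : Finset X.Vertex) (m : X.Vertex → ℝ≥0∞),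
      (∀ v ∈ F, v.level = n) → ∫⁻ z, X.density F m n z ^ Q ∂μ ≤ K * ∑ v ∈ F, m v ^ Q := by
  classical
  have hQ0 : 0 < Q := by linarith
  obtain ⟨C, hC, hCb⟩ := hμ.exists_measure_ball_le hQ0
  obtain ⟨M, hM⟩ := X.exists_encard_vertex_le hQ0 hμ (K := 4) (by norm_num)
  refine ⟨(M : ℝ≥0∞) ^ (Q - 1) * ENNReal.ofReal (C * 2 ^ Q), ENNReal.mul_ne_top
    (ENNReal.rpow_ne_top_of_nonneg (by linarith) (ENNReal.natCast_ne_top M))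
    ENNReal.ofReal_ne_top, fun n F m hF => ?_⟩
  have hmesh := X.mesh_pos n
  set r : ℝ := 2 * X.mesh n with hr
  have hr0 : 0 < r := by positivity
  have hpt : ∀ z, X.density F m n z ^ Q ≤ (M : ℝ≥0∞) ^ (Q - 1) *
      ∑ v ∈ F, (Metric.ball v.center (2 * r)).indicator
        (fun _ => (m v / ENNReal.ofReal r) ^ Q) z := by
    intro z
    have h1 : X.density F m n z =
        ∑ v ∈ F.filter fun v => z ∈ Metric.ball v.center (2 * r), m v / ENNReal.ofReal r := by
      rw [density, Finset.sum_filter]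
      rfl
    have h2 : ∑ v ∈ F, (Metric.ball v.center (2 * r)).indicator
        (fun _ => (m v / ENNReal.ofReal r) ^ Q) z =
        ∑ v ∈ F.filter fun v => z ∈ Metric.ball v.center (2 * r),
          (m v / ENNReal.ofReal r) ^ Q := by
      rw [Finset.sum_filter]
      rfl
    have hcard : (F.filter fun v => z ∈ Metric.ball v.center (2 * r)).card ≤ M := by
      have h3 : ((F.filter fun v => z ∈ Metric.ball v.center (2 * r) : Finset X.Vertex) :
          Set X.Vertex).encard ≤ M := by
        refine (encard_le_encard fun v hv => ?_).trans (hM n z)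
        rw [Finset.mem_coe, Finset.mem_filter, Metric.mem_ball, dist_comm] at hv
        refine ⟨hF v hv.1, hv.2.trans_eq ?_⟩
        rw [hr]; ring
      rw [encard_coe_eq_coe_finsetCard] at h3
      exact_mod_cast h3
    rw [h1, h2]
    refine (ENNReal.rpow_sum_le_const_mul_sum_rpow _ _ hQ).trans ?_
    gcongr
  have hball : ∀ v : X.Vertex, (m v / ENNReal.ofReal r) ^ Q * μ (Metric.ball v.center (2 * r)) ≤
      ENNReal.ofReal (C * 2 ^ Q) * m v ^ Q := by
    intro v
    have hrQ : ENNReal.ofReal (r ^ Q) ≠ 0 :=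
      (ENNReal.ofReal_pos.2 (Real.rpow_pos_of_pos hr0 _)).ne'
    calc (m v / ENNReal.ofReal r) ^ Q * μ (Metric.ball v.center (2 * r))
        ≤ (m v / ENNReal.ofReal r) ^ Q * ENNReal.ofReal (C * (2 * r) ^ Q) := by
          gcongr; exact hCb _ _ (by positivity)
      _ = m v ^ Q / ENNReal.ofReal (r ^ Q) *
            (ENNReal.ofReal (C * 2 ^ Q) * ENNReal.ofReal (r ^ Q)) := by
          rw [ENNReal.div_rpow_of_nonneg _ _ hQ0.le, ENNReal.ofReal_rpow_of_pos hr0,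
            ← ENNReal.ofReal_mul (by positivity), Real.mul_rpow (by norm_num) hr0.le, mul_assoc]
      _ = ENNReal.ofReal (C * 2 ^ Q) *
            (m v ^ Q / ENNReal.ofReal (r ^ Q) * ENNReal.ofReal (r ^ Q)) := by
          ring
      _ = _ := by rw [ENNReal.div_mul_cancel hrQ ENNReal.ofReal_ne_top]
  have hmeas : ∀ v ∈ F, Measurable fun z => (Metric.ball v.center (2 * r)).indicator
      (fun _ => (m v / ENNReal.ofReal r) ^ Q) z := fun v _ =>
    measurable_const.indicator Metric.isOpen_ball.measurableSet
  refine (lintegral_mono hpt).trans ?_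
  rw [lintegral_const_mul _ (Finset.measurable_fun_sum _ hmeas),
    lintegral_finsetSum _ hmeas, mul_assoc,
    Finset.mul_sum _ _ (ENNReal.ofReal (C * 2 ^ Q))]
  gcongr with v hv
  rw [lintegral_indicator_const Metric.isOpen_ball.measurableSet]
  exact hball v

/-- If some weak capacity between two open sets at positive distance is finite for an exponent below
the dimension, then the paths meeting both sets form a family of modulus zero. -/
theorem pathModulus_eq_zero_of_wcap_ne_top (hQ : 1 < Q) (hμ : IsAhlforsRegular μ Q) {q : ℝ}
    (hq : 0 < q) (hqQ : q < Q) {A B : Set Z} (hA : IsOpen A) (hB : IsOpen B)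
    (hAB : 0 < setDist A B) (hw : X.wcap q A B ≠ ∞) :
    pathModulus μ Q {γ : MetricPath Z | (∃ t ∈ γ.dom, γ.toFun t ∈ A) ∧
      ∃ t ∈ γ.dom, γ.toFun t ∈ B} = 0 := by
  have hQ0 : 0 < Q := by linarith
  have : Countable X.Vertex := X.countable_vertex hQ0 hμ
  have hne : ∀ a ∈ A, ∀ b ∈ B, a ≠ b := by
    rintro a ha _ hb rfl
    have h : setDist A B ≤ edist a a := iInf₂_le_of_le a ha (iInf₂_le a hb)
    rw [edist_self] at h
    exact hAB.not_ge h
  obtain ⟨τ, hτ⟩ := iInf_lt_iff.1 hw.lt_top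
  obtain ⟨hadm, hτ⟩ := iInf_lt_iff.1 hτ
  have hweak : weakNorm q τ ≠ ∞ := fun h => by
    rw [h, ENNReal.top_rpow_of_pos hq] at hτ
    exact lt_irrefl _ hτ
  obtain ⟨K, hK⟩ := exists_hasWeakBound_of_weakNorm_ne_top hweak
  have hm := HyperbolicFilling.HasWeakBound.vertexSup hK
  obtain ⟨K', hK', hdens⟩ := X.exists_lintegral_density_rpow_le hQ.le hμ
  set F : ℕ → Finset X.Vertex := fun n => (X.finite_level hQ0 hμ n).toFinset with hF
  have hFmem : ∀ n (v : X.Vertex), v ∈ F n ↔ v.level = n := fun n v =>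
    (X.finite_level hQ0 hμ n).mem_toFinset
  refine pathModulus_eq_zero_of_frequently hQ0
    (fun n => X.measurable_density (F n) (vertexSup τ) n) ?_ ?_
  · refine ne_top_of_le_ne_top ?_ (ENNReal.tsum_le_tsum fun n =>
      hdens n (F n) (vertexSup τ) fun v hv => (hFmem n v).1 hv)
    rw [ENNReal.tsum_mul_left]
    exact ENNReal.mul_ne_top hK' (ne_top_of_le_ne_top (hm.tsum_rpow_ne_top hq hqQ)
      (X.tsum_sum_level_le (fun n v hv => (hFmem n v).1 hv) _))
  · rintro γ ⟨⟨s, hs, hsA⟩, t, ht, htB⟩ hγ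
    have hD : 0 < dist (γ.toFun s) (γ.toFun t) := dist_pos.2 (hne _ hsA _ htB)
    obtain ⟨δ, hδ, hδA⟩ := Metric.isOpen_iff.1 hA _ hsA
    obtain ⟨δ', hδ', hδB⟩ := Metric.isOpen_iff.1 hB _ htB
    -- The given points may be bad. Near each of them the path passes through good points, still in
    -- `A` or `B` by openness.
    obtain ⟨bA, hbA, hnA⟩ := volume_dist_image_badSet hq hm (γ.toFun s)
    obtain ⟨bB, hbB, hnB⟩ := volume_dist_image_badSet hq hm (γ.toFun t)
    obtain ⟨u, hu, hud, hub⟩ := γ.exists_dist_lt_notMem hs ht (lt_min hδ hD) (min_le_right _ _) hnA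
    obtain ⟨w, hw, hwd, hwb⟩ := γ.exists_dist_lt_notMem ht hs (lt_min hδ' hD)
      ((min_le_right _ _).trans_eq (dist_comm _ _)) hnB
    have huA : γ.toFun u ∈ A := hδA (by
      rw [Metric.mem_ball, dist_comm]; exact hud.trans_le (min_le_left _ _))
    have hwB : γ.toFun w ∈ B := hδB (by
      rw [Metric.mem_ball, dist_comm]; exact hwd.trans_le (min_le_left _ _))
    exact (X.eventually_half_le_lineIntegral hadm hbA hbB hγ hu hw huA hwB (hne _ huA _ hwB) hub hwb
      fun n v hv => (hFmem n v).2 hv).frequently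

end Regular

end HyperbolicFilling

/-! ### Conformal dimension and the critical exponent -/

section Main

variable {Z : Type*} [MetricSpace Z] [MeasurableSpace Z] {μ : Measure Z} {Q : ℝ}

theorem nontrivial_of_pathModulus_pos {p : ℝ} (hp : 0 < p) {Γ : Set (MetricPath Z)}
    (hΓ : ∀ γ ∈ Γ, γ.Nonconstant) (h : 0 < pathModulus μ p Γ) : Nontrivial Z := by
  rcases Γ.eq_empty_or_nonempty with rfl | ⟨γ, hγ⟩
  · refine absurd h (not_lt.2 ((iInf₂_le 0 ⟨measurable_zero, fun γ hγ => hγ.elim⟩).trans ?_))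
    simp [hp]
  · exact (hΓ γ hγ).nontrivial

/-- A family of nonconstant paths of positive modulus contains a subfamily of positive modulus of
paths joining two fixed balls at positive distance. -/
theorem exists_ball_pathModulus_ne_zero [CompactSpace Z] (hQ : 0 < Q) {Γ : Set (MetricPath Z)}
    (hΓ : ∀ γ ∈ Γ, γ.Nonconstant) (h : pathModulus μ Q Γ ≠ 0) :
    ∃ (a b : Z) (r : ℝ), 0 < r ∧ 0 < setDist (Metric.ball a r) (Metric.ball b r) ∧
      pathModulus μ Q {γ : MetricPath Z | (∃ t ∈ γ.dom, γ.toFun t ∈ Metric.ball a r) ∧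
        ∃ t ∈ γ.dom, γ.toFun t ∈ Metric.ball b r} ≠ 0 := by
  by_contra! hcon
  have : Nonempty Z := by
    by_contra hZ
    rw [not_nonempty_iff] at hZ
    refine h (le_antisymm ((pathModulus_mono (Γ' := ∅) fun γ _ => ?_).trans
      ((iInf₂_le 0 ⟨measurable_zero, fun γ hγ => hγ.elim⟩).trans (by simp [hQ]))) zero_le)
    exact (hZ.false (γ.toFun 0)).elim
  -- Centers in a dense sequence and radii `1 / (n + 1)` leave countably many pairs of balls.
  set x := TopologicalSpace.denseSeq Z
  set ρ : ℕ → ℝ := fun n => 1 / ((n : ℝ) + 1) with hρ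
  have hρ0 : ∀ n, 0 < ρ n := fun n => by positivity
  refine h (le_antisymm ((pathModulus_mono fun γ hγ => ?_).trans_eq (pathModulus_iUnion_eq_zero hQ
    (ι := {i : ℕ × ℕ × ℕ // 0 < setDist (Metric.ball (x i.1) (ρ i.2.2))
      (Metric.ball (x i.2.1) (ρ i.2.2))}) fun i => hcon _ _ _ (hρ0 _) i.2)) zero_le)
  obtain ⟨t, ht, t', ht', hne⟩ := hΓ γ hγ
  have hd : 0 < dist (γ.toFun t) (γ.toFun t') := dist_pos.2 hne
  -- Points of the two balls are within `2 * ρ n` of the chosen path points, so radii below an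
  -- eighth of their distance keep the balls half that distance apart.
  obtain ⟨n, hn⟩ := exists_nat_one_div_lt (show 0 < dist (γ.toFun t) (γ.toFun t') / 8 by positivity)
  obtain ⟨i, hi⟩ := (TopologicalSpace.denseRange_denseSeq Z).exists_dist_lt (γ.toFun t) (hρ0 n)
  obtain ⟨j, hj⟩ := (TopologicalSpace.denseRange_denseSeq Z).exists_dist_lt (γ.toFun t') (hρ0 n)
  refine mem_iUnion.2 ⟨⟨(i, j, n), ?_⟩, ⟨t, ht, hi⟩, t', ht', hj⟩
  refine (ENNReal.ofReal_pos.2 (half_pos hd)).trans_le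
    (le_iInf₂ fun y hy => le_iInf₂ fun z hz => ?_)
  rw [edist_dist]
  refine ENNReal.ofReal_le_ofReal ?_
  rw [Metric.mem_ball] at hy hz
  have hn' : ρ n < dist (γ.toFun t) (γ.toFun t') / 8 := hn
  have h1 := dist_triangle4 (γ.toFun t) y z (γ.toFun t')
  have h2 := dist_triangle_right (γ.toFun t) y (x i)
  have h3 := dist_triangle_right z (γ.toFun t') (x j)
  simp only at hy hz
  linarith [show dist (γ.toFun t) (x i) < ρ n from hi, show dist (γ.toFun t') (x j) < ρ n from hj]

variable [BorelSpace Z]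

theorem IsAhlforsRegular.isAhlforsRegularSpace (hQ : 0 < Q) (hμ : IsAhlforsRegular μ Q) :
    IsAhlforsRegularSpace Z := by
  obtain rfl : ‹MeasurableSpace Z› = borel Z := BorelSpace.measurable_eq
  exact ⟨Q, μ, hQ, hμ⟩

variable [CompactSpace Z] [ConnectedSpace Z] [Nontrivial Z]

/-- Infinite weak capacities below `Q` bound the Hausdorff dimension of all Ahlfors regular
quasisymmetric images from below. -/
theorem ofReal_le_dimH_of_isQuasisymmetry {Y : Type*}
    [MetricSpace Y] (hQ : 0 < Q) (hμ : IsAhlforsRegular μ Q) (X : HyperbolicFilling Z) {A B : Set Z}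
    (hAB : 0 < setDist A B) (hw : ∀ q : ℝ, 0 < q → q < Q → X.wcap q A B = ∞) {f : Z → Y}
    (hf : IsQuasisymmetry f) (hbij : Function.Bijective f) (hY : IsAhlforsRegularSpace Y) :
    ENNReal.ofReal Q ≤ dimH (univ : Set Y) := by
  let : MeasurableSpace Y := borel Y
  have : BorelSpace Y := ⟨rfl⟩
  obtain ⟨Q', ν, hQ', hν⟩ := hY
  have : CompactSpace Y := ⟨by
    rw [← hbij.2.range_eq]; exact isCompact_range hf.continuous⟩
  have : Nontrivial Y := hbij.1.nontrivial
  refine le_trans (ENNReal.ofReal_le_ofReal ?_) (hν.le_dimH hQ')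
  by_contra! hlt
  obtain ⟨q, hq, hqQ⟩ := exists_between hlt
  exact (X.wcap_lt_top_of_isQuasisymmetry hQ hμ hQ' hν hf hbij hq hAB).ne
    (hw q (hQ'.trans hq) hqQ)

theorem arConformalDim_eq (hQ : 0 < Q)
    (hμ : IsAhlforsRegular μ Q) (X : HyperbolicFilling Z) {A B : Set Z} (hAB : 0 < setDist A B)
    (hw : ∀ q : ℝ, 0 < q → q < Q → X.wcap q A B = ∞) :
    arConformalDim Z = ENNReal.ofReal Q := by
  refine le_antisymm ?_ ?_
  · exact iInf_le_of_le _ (iInf_le_of_le (isQuasisymmetry_id Z)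
      (iInf_le_of_le (hμ.isAhlforsRegularSpace hQ) (hμ.dimH_le hQ)))
  · have key : ∀ {Y : Type _} [MetricSpace Y] (f : Z → Y), IsQuasisymmetry f →
        Function.Bijective f → IsAhlforsRegularSpace Y →
        ENNReal.ofReal Q ≤ dimH (univ : Set Y) := fun f hf hbij hY =>
      ofReal_le_dimH_of_isQuasisymmetry hQ hμ X hAB hw hf hbij hY
    exact le_iInf fun θ => le_iInf fun hqs => le_iInf fun hreg =>
      @key Z θ id hqs Function.bijective_id hreg

/-- Above `Q` the identity map gives finiteness for all pairs; below `Q` the single pair `A`, `B`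
excludes an exponent. -/
theorem HyperbolicFilling.Qw_eq (hQ : 0 < Q)
    (hμ : IsAhlforsRegular μ Q) (X : HyperbolicFilling Z) {A B : Set Z} (hA : IsOpen A)
    (hB : IsOpen B) (hAB : 0 < setDist A B) (hw : ∀ q : ℝ, 0 < q → q < Q → X.wcap q A B = ∞) :
    X.Qw = ENNReal.ofReal Q := by
  refine le_antisymm ?_ ?_
  · have hlim : Tendsto ENNReal.ofReal (𝓝[>] Q) (𝓝 (ENNReal.ofReal Q)) :=
      (ENNReal.continuous_ofReal.tendsto Q).mono_left nhdsWithin_le_nhds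
    refine ge_of_tendsto hlim (eventually_nhdsWithin_of_forall fun q hq => ?_)
    refine iInf₂_le q ⟨hQ.trans hq, fun A B _ _ hAB => ?_⟩
    exact X.wcap_lt_top_of_isQuasisymmetry hQ hμ hQ hμ (isQuasisymmetry_id Z)
      Function.bijective_id hq hAB
  · refine le_iInf₂ fun q hq => ENNReal.ofReal_le_ofReal ?_
    by_contra! hlt
    exact (hq.2 A B hA hB hAB).ne (hw q hq.1 hlt)

end Main

theorem mainTheorem9 {Z : Type*} [MetricSpace Z] [CompactSpace Z] [ConnectedSpace Z]
    [MeasurableSpace Z] [BorelSpace Z] (μ : Measure Z) (Q : ℝ) (hQ : 1 < Q)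
    (hμ : IsAhlforsRegular μ Q)
    (hΓ : ∃ p : ℝ, 1 ≤ p ∧ p ≤ Q ∧ ∃ Γ : Set (MetricPath Z),
      (∀ γ ∈ Γ, γ.Nonconstant) ∧ 0 < pathModulus μ p Γ) :
    (∃ (a b : Z) (r r' : ℝ), 0 < r ∧ 0 < r' ∧
      0 < setDist (Metric.ball a r) (Metric.ball b r') ∧
      ∀ (X : HyperbolicFilling Z) (q : ℝ), 0 < q → q < Q →
        X.wcap q (Metric.ball a r) (Metric.ball b r') = ∞) ∧
    arConformalDim Z = ENNReal.ofReal Q ∧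
    ∀ X : HyperbolicFilling Z, X.Qw = arConformalDim Z := by
  obtain ⟨p, hp, hpQ, Γ, hnc, hpos⟩ := hΓ
  have hp0 : 0 < p := by linarith
  have hQ0 : 0 < Q := by linarith
  have : Nontrivial Z := nontrivial_of_pathModulus_pos hp0 hnc hpos
  have hfin := hμ.isFiniteMeasure
  obtain ⟨a, b, r, hr, hab, hmod⟩ := exists_ball_pathModulus_ne_zero (μ := μ) hQ0 hnc
    fun h => hpos.ne' (pathModulus_eq_zero_of_le hp0 hpQ h)
  have hw : ∀ (X : HyperbolicFilling Z) (q : ℝ), 0 < q → q < Q →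
      X.wcap q (Metric.ball a r) (Metric.ball b r) = ∞ := fun X q hq hqQ => by
    by_contra hne
    exact hmod (X.pathModulus_eq_zero_of_wcap_ne_top hQ hμ hq hqQ Metric.isOpen_ball
      Metric.isOpen_ball hab hne)
  have hdim : arConformalDim Z = ENNReal.ofReal Q := by
    -- The conformal dimension does not involve a filling, so any one serves.
    obtain ⟨X⟩ := exists_hyperbolicFilling Z
    exact arConformalDim_eq hQ0 hμ X hab (hw X)
  refine ⟨⟨a, b, r, r, hr, hr, hab, hw⟩, hdim, fun X => ?_⟩
  rw [hdim]
  exact X.Qw_eq hQ0 hμ Metric.isOpen_ball Metric.isOpen_ball hab (hw X)
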